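/- **Setting.** Let $G$ be a finite group, $H$ a finite abelian group, and $R$ a commutative unital ring with involution $*$, with group of units $R^*$, such that $\#G$ and $\#H$ are invertible in $R$. *Bracket convention.* Given $\alpha^1\colon H^3\to R^*$, a word $[x_1,\dots,x_n]$ in $H$ denotes the composite $((x_1x_2)x_3\cdots)x_n$, parenthesized from left to right. A scalar $r\in R^*$ may be regarded as a 2-morphism $u\Rightarrow v$ between two words with the same product in $H$. Applied inside a word $A\,u\,B$ it contributes the factor $\lceil r\rceil$, which is $r$ times the string of 1-associators $\alpha^1_{a,b,c}\colon a(bc)\Rightarrow(ab)c$ needed to pass from $A\,u\,B$ to $A(u)B$, and from $A(v)B$ to $A\,v\,B$. Explicitly, if $a$ is the product of $A$ and $c(a,[x_1,\dots,x_n])=\prod_k\alpha^1_{a,\,x_1\cdots x_{k-1},\,x_k}$, then $\lceil r\rceil=c(a,u)^{-1}\,r\,c(a,v)$. Each bracketed identity below says that the two indicated ways round a diagram of words agree; bracketed 2-morphisms (those of the maps themselves, or identities) that contribute the same scalar to both sides of the diagram are not written. *Semi-weak monoidal 2-category structure on $\mathbb N(G,H,R)$:* maps $\alpha^0\colon G^3\to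 H$, $\pi\colon G^4\to R^*$, $\alpha^1\colon H^3\to R^*$, $\tau\colon H^2\to R^*$, $\iota^1\colon H\times G^2\to R^*$, $\iota^2\colon G\times H\times G\to R^*$, $\iota^3\colon G^2\times H\to R^*$, each equal to $1$ when one of its arguments is $1$. As 2-morphisms, $\pi_{g_1,g_2,g_3,g_4}$ goes from $[\alpha^0_{g_2,g_3,g_4},\alpha^0_{g_1,g_2g_3,g_4},\alpha^0_{g_1,g_2,g_3}]$ to $[\alpha^0_{g_1,g_2,g_3g_4},\alpha^0_{g_1g_2,g_3,g_4}]$; $\tau_{h_1,h_2}\colon[h_1,h_2]\Rightarrow[h_2,h_1]$; and $\iota^k$ goes from $[\alpha^0_{g_1,g_2,g_3},h]$ to $[h,\alpha^0_{g_1,g_2,g_3}]$, where $h$ acts on the $k$-th factor. The maps satisfy, for all arguments (including the elements of $G$ that occur only in the words): * $\alpha^0$ and $\alpha^1$ are 3-cocycles: $\alpha_{y,z,w}(\alpha_{xy,z,w})^{-1}\alpha_{x,yz,w}(\alpha_{x,y,zw})^{-1}\alpha_{x,y,z}=1$; * $\lceil\tau_{h_1h_2,h_3}\rceil=\lceil\tau_{h_2,h_3}\rceil\lceil\tau_{h_1,h_3}\rceil$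 and $\lceil\tau_{h_1,h_2h_3}\rceil=\lceil\tau_{h_1,h_2}\rceil\lceil\tau_{h_1,h_3}\rceil$; * $\lceil\pi_{g_2,g_3,g_4,g_5}\rceil\lceil\pi_{g_1,g_2g_3,g_4,g_5}\rceil\lceil\iota^1_{\alpha^0_{g_1,g_2,g_3},g_4,g_5}\rceil\lceil\pi_{g_1,g_2,g_3,g_4g_5}\rceil=\lceil(\iota^2_{g_1,\alpha^0_{g_2,g_3,g_4},g_5})^{-1}\rceil\lceil\pi_{g_1,g_2,g_3,g_4}\rceil\lceil\pi_{g_1,g_2,g_3g_4,g_5}\rceil\lceil(\iota^3_{g_1,g_2,\alpha^0_{g_3,g_4,g_5}})^{-1}\rceil\lceil\pi_{g_1g_2,g_3,g_4,g_5}\rceil$; * $\lceil\iota^1_{h,g_2,g_3}\rceil\lceil\iota^1_{h,g_2g_3,g_4}\rceil\lceil\tau^{-1}_{h,\alpha^0_{g_2,g_3,g_4}}\rceil=\lceil\iota^1_{h,g_3,g_4}\rceil\lceil\iota^1_{h,g_2,g_3g_4}\rceil$; * $\lceil\iota^2_{g_1,h,g_3g_4}\rceil=\lceil\iota^2_{g_1,h,g_3}\rceil\lceil\iota^2_{g_1,h,g_4}\rceil$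 and $\lceil\iota^2_{g_1g_2,h,g_4}\rceil=\lceil\iota^2_{g_1,h,g_4}\rceil\lceil\iota^2_{g_2,h,g_4}\rceil$; * $\lceil\tau_{\alpha^0_{g_1,g_2,g_3},h}\rceil\lceil\iota^3_{g_1,g_2g_3,h}\rceil\lceil\iota^3_{g_2,g_3,h}\rceil=\lceil\iota^3_{g_1g_2,g_3,h}\rceil\lceil\iota^3_{g_1,g_2,h}\rceil$; * each $\lceil\iota^k\rceil$ is multiplicative in its argument in $H$. *2-equivalence* from such a structure to another one (marked by primes): group automorphisms of $G$ and $H$ and a unital ring automorphism of $R$ preserving $*$, all written $x\mapsto\overline x$, together with normalized maps $\mu\colon H^2\to R^*$, $\Phi\colon G^2\to H$, $\phi\colon G^3\to R^*$, $\psi\colon H\times G\to R^*$, $\chi\colon G\times H\to R^*$. Here $\mu_{h_1,h_2}\colon\overline{h_1h_2}\Rightarrow\overline{h}_1\overline{h}_2$; $\phi_{g_1,g_2,g_3}$ goes from $[\overline{\alpha^0_{g_1,g_2,g_3}},\Phi_{g_1g_2,g_3},\Phi_{g_1,g_2}]$ to $[\Phi_{g_1,g_2g_3},\Phi_{g_2,g_3},(\alpha^0)'_{\overline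 g_1,\overline g_2,\overline g_3}]$; and $\psi_{h,g_2}$ and $\chi_{g_1,h}$ go from $[\Phi_{g_1,g_2},\overline h]$ to $[\overline h,\Phi_{g_1,g_2}]$, with $h$ acting on the first, respectively second, factor. They satisfy (with brackets formed using $(\alpha^1)'$ and $\mu$): 1. $\overline{\alpha^0_{g_1,g_2,g_3}}\Phi_{g_1g_2,g_3}\Phi_{g_1,g_2}=\Phi_{g_1,g_2g_3}\Phi_{g_2,g_3}(\alpha^0)'_{\overline g_1,\overline g_2,\overline g_3}$; 2. $\overline{\alpha^1_{h_1,h_2,h_3}}\mu_{h_1h_2,h_3}\mu_{h_1,h_2}=\mu_{h_1,h_2h_3}\mu_{h_2,h_3}(\alpha^1)'_{\overline h_1,\overline h_2,\overline h_3}$; 3. $\lceil\overline{\tau_{h_1,h_2}}\rceil=\lceil\tau'_{\overline h_1,\overline h_2}\rceil$; 4. $\lceil\psi_{h,g_2}\rceil\lceil\psi_{h,g_3}\rceil\lceil\overline{\iota^1_{h,g_2,g_3}}\rceil=\lceil(\iota^1)'_{\overline h,\overline g_2,\overline g_3}\rceil\lceil(\tau')^{-1}_{\overline h,\Phi_{g_2,g_3}}\rceil\lceil\psi_{h,g_2g_3}\rceil$;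 5. $\lceil\overline{\iota^2_{g_1,h,g_3}}\rceil=\lceil(\iota^2)'_{\overline g_1,\overline h,\overline g_3}\rceil$; 6. $\lceil\tau'_{\Phi_{g_1,g_2},\overline h}\rceil\lceil\chi_{g_1g_2,h}\rceil\lceil\overline{\iota^3_{g_1,g_2,h}}\rceil=\lceil(\iota^3)'_{\overline g_1,\overline g_2,\overline h}\rceil\lceil\chi_{g_2,h}\rceil\lceil\chi_{g_1,h}\rceil$; 7. $\lceil\psi_{h_1h_2,g}\rceil=\lceil\psi_{h_1,g}\rceil\lceil\psi_{h_2,g}\rceil$; 8. $\lceil\chi_{g,h_1h_2}\rceil=\lceil\chi_{g,h_1}\rceil\lceil\chi_{g,h_2}\rceil$; 9. $\lceil\psi^{-1}_{\alpha^0_{g_1,g_2,g_3},g_4}\rceil\lceil\phi_{g_1,g_2,g_3}\rceil\lceil\phi_{g_1,g_2g_3,g_4}\rceil\lceil(\iota^2)'_{\overline g_1,\Phi_{g_2,g_3},\overline g_4}\rceil\lceil\chi^{-1}_{g_1,\alpha^0_{g_2,g_3,g_4}}\rceil\lceil\phi_{g_2,g_3,g_4}\rceil\lceil\pi'_{\overline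 g_1,\overline g_2,\overline g_3,\overline g_4}\rceil=\lceil\overline{\pi_{g_1,g_2,g_3,g_4}}\rceil\lceil\phi_{g_1g_2,g_3,g_4}\rceil\lceil(\iota^1)'_{\Phi_{g_1,g_2},\overline g_3,\overline g_4}\rceil\lceil(\tau')^{-1}_{\Phi_{g_1,g_2},\Phi_{g_3,g_4}}\rceil\lceil\phi_{g_1,g_2,g_3g_4}\rceil\lceil(\iota^3)'_{\overline g_1,\overline g_2,\Phi_{g_3,g_4}}\rceil$. *State-sum.* Let $M$ be a closed oriented PL 4-manifold with a triangulation $\mathcal T$ whose vertices are totally ordered, with $v_0$ vertices and $v_1$ edges. A labelling $\ell$ assigns $g_{ij}\in G$ to each edge and $h_{ijk}\in H$ to each triangle (vertices in increasing order) such that $g_{ij}g_{ik}^{-1}g_{jk}=1$ on each triangle and $h_{jkl}h_{ikl}^{-1}h_{ijl}h_{ijk}^{-1}=\alpha^0_{g_{kl},g_{jk},g_{ij}}$ on each tetrahedron. For a 4-simplex $S=(ijklm)$ put $$Z(S,\ell)=\lceil(\iota^3_{g_{lm},g_{kl},h_{ijk}})^{-1}\rceil\lceil\tau_{h_{klm},h_{ijk}}\rceil\lceil(\iota^1_{h_{klm},g_{jk},g_{ij}})^{-1}\rceil\lceil\iota^2_{g_{lm},h_{jkl},g_{ij}}\rceil\lceil\pi_{g_{lm},g_{kl},g_{jk},g_{ij}}\rceil,$$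 the composite from the word $[h_{ilm},h_{ikl},h_{ijk},\alpha^0_{g_{lm},g_{kl},g_{jk}g_{ij}},\alpha^0_{g_{lm}g_{kl},g_{jk},g_{ij}}]$ to itself in which each of the five tetrahedra is used once to rewrite $[h_{ikl},h_{ijk},\alpha^0_{g_{kl},g_{jk},g_{ij}}]=[h_{ijl},h_{jkl}]$, or the reverse, by an identity 2-morphism. With $\epsilon(S)=\pm1$ according to whether the vertex order of $S$ agrees with the orientation of $M$, $$Z(M,\mathcal T)=(\#G)^{-v_0}(\#H)^{v_0-v_1}\sum_\ell\prod_S Z(S,\ell)^{\epsilon(S)}.$$ **Theorem.** Suppose that two semi-weak monoidal 2-category structures on $\mathbb N(G,H,R)$ are 2-equivalent by the above data, and let $Z$ and $Z'$ be the state-sums that they define. Then for every closed oriented PL 4-manifold $M$ and every triangulation $\mathcal T$ of $M$ with totally ordered vertices, $$Z'(M,\mathcal T)=\overline{Z(M,\mathcal T)},$$ where the bar is the automorphism of $R$ that belongs to the 2-equivalence. In particular, if this automorphism is the identity, then $Z'(M,\mathcal T)=Z(M,\mathcal T)$. -/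

import Mathlib

/-! ## Bracketed 2-morphisms

A 2-morphism between composites of simple 1-morphisms is an invertible scalar. A word
`[x₁, x₂, …, xₙ]` in `H` stands for the composite `((x₁ x₂) x₃ …) xₙ`, parenthesized from left to
right, in diagrammatic order. -/

/-- Auxiliary recursion for `reassoc`; `p` is the product of the letters already absorbed. -/
def reassocAux {H K : Type*} [Monoid H] [Monoid K] (α : H → H → H → K) (a : H) : H → List H → K
  | _, [] => 1
  | p, x :: w => α a p x * reassocAux α a (p * x) w

/-- The string of 1-associators `a ((x₁ x₂) … xₙ) ⇒ ((a x₁) x₂) … xₙ`. -/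
def reassoc {H K : Type*} [Monoid H] [Monoid K] (α : H → H → H → K) (a : H) (w : List H) : K :=
  reassocAux α a 1 w

/-- The bracket `⌈r⌉` of a 2-morphism `r : u ⇒ v` that is applied to the subword `u` of a word
`A ++ u ++ B`. It is the composite
`A ++ u ++ B ⇒ A (u) ++ B ⇒ A (v) ++ B ⇒ A ++ v ++ B` of a string of inverse 1-associators, of the
whiskered `r`, and of a string of 1-associators. The letters `B` to the right of the subword need
no rebracketing. With `r = 1` it is the identity of a composite that is written as a word in two
ways. -/
def bracket {H K : Type*} [Monoid H] [CommGroup K] (α : H → H → H → K)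
    (A u v : List H) (r : K) : K :=
  (reassoc α A.prod u)⁻¹ * r * reassoc α A.prod v

/-! ## Semi-weak monoidal 2-category structures on `ℕ(G, H, R)` -/

/-- The structural maps. As 2-morphisms between words:
`π` goes from `[α₀ g₂ g₃ g₄, α₀ g₁ (g₂g₃) g₄, α₀ g₁ g₂ g₃]` to
`[α₀ g₁ g₂ (g₃g₄), α₀ (g₁g₂) g₃ g₄]`; `α₁ a b c : a(bc) ⇒ (ab)c`; `τ a b : [a, b] ⇒ [b, a]`; and
each interchanger goes from `[α₀ g₁ g₂ g₃, h]` to `[h, α₀ g₁ g₂ g₃]`, where `h` acts on the first,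
second or third of the three tensor factors. -/
structure StructureMaps (G H R : Type*) [CommRing R] where
  /-- the 0-associator -/
  α₀ : G → G → G → H
  /-- the pentagonator -/
  π : G → G → G → G → Rˣ
  /-- the 1-associator -/
  α₁ : H → H → H → Rˣ
  /-- the tensorator -/
  τ : H → H → Rˣ
  /-- interchanger 1 -/
  ι₁ : H → G → G → Rˣ
  /-- interchanger 2 -/
  ι₂ : G → H → G → Rˣ
  /-- interchanger 3 -/
  ι₃ : G → G → H → Rˣ

/-- The coherence cube of an endomorphism `h` of one of the factors of `g₁g₂g₃g₄` with the
pentagonator. The scalars `tz, ty, tx` move `h` to the left past `z = α₀ g₁ g₂ g₃`,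
`y = α₀ g₁ (g₂g₃) g₄`, `x = α₀ g₂ g₃ g₄`, and `tq, tp` move it past `q = α₀ (g₁g₂) g₃ g₄`,
`p = α₀ g₁ g₂ (g₃g₄)`. The two composites from `[x, y, z, h]` to `[h, p, q]` agree. -/
def StructureMaps.PentagonCube {G H R : Type*} [Group G] [CommGroup H] [CommRing R]
    (S : StructureMaps G H R) (g₁ g₂ g₃ g₄ : G) (h : H) (tz ty tx tq tp : Rˣ) : Prop :=
  let br := bracket S.α₁
  let x := S.α₀ g₂ g₃ g₄
  let y := S.α₀ g₁ (g₂ * g₃) g₄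
  let z := S.α₀ g₁ g₂ g₃
  let p := S.α₀ g₁ g₂ (g₃ * g₄)
  let q := S.α₀ (g₁ * g₂) g₃ g₄
  br [x, y] [z, h] [h, z] tz * br [x] [y, h] [h, y] ty * br [] [x, h] [h, x] tx *
      br [h] [x, y, z] [p, q] (S.π g₁ g₂ g₃ g₄) =
    br [] [x, y, z] [p, q] (S.π g₁ g₂ g₃ g₄) * br [p] [q, h] [h, q] tq * br [] [p, h] [h, p] tp

/-- Multiplicativity of a move past `a`: moving the composite `h₁h₂` to the left past `a` by `t` is
the same as moving `h₁` by `t₁` and then `h₂` by `t₂`. -/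
def StructureMaps.MoveMul {G H R : Type*} [Group G] [CommGroup H] [CommRing R]
    (S : StructureMaps G H R) (a h₁ h₂ : H) (t t₁ t₂ : Rˣ) : Prop :=
  let br := bracket S.α₁
  br [a] [h₁, h₂] [h₁ * h₂] 1 * br [] [a, h₁ * h₂] [h₁ * h₂, a] t * br [] [h₁ * h₂] [h₁, h₂] 1 =
    br [] [a, h₁] [h₁, a] t₁ * br [h₁] [a, h₂] [h₂, a] t₂

/-- A semi-weak monoidal 2-category structure on `ℕ(G, H, R)`. -/
structure SemiWeakStructure (G H R : Type*) [Group G] [CommGroup H] [CommRing R]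
    extends StructureMaps G H R where
  α₀_norm : ∀ g₁ g₂ g₃, g₁ = 1 ∨ g₂ = 1 ∨ g₃ = 1 → α₀ g₁ g₂ g₃ = 1
  π_norm : ∀ g₁ g₂ g₃ g₄, g₁ = 1 ∨ g₂ = 1 ∨ g₃ = 1 ∨ g₄ = 1 → π g₁ g₂ g₃ g₄ = 1
  α₁_norm : ∀ h₁ h₂ h₃, h₁ = 1 ∨ h₂ = 1 ∨ h₃ = 1 → α₁ h₁ h₂ h₃ = 1
  τ_norm : ∀ h₁ h₂, h₁ = 1 ∨ h₂ = 1 → τ h₁ h₂ = 1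
  ι₁_norm : ∀ h g₂ g₃, h = 1 ∨ g₂ = 1 ∨ g₃ = 1 → ι₁ h g₂ g₃ = 1
  ι₂_norm : ∀ g₁ h g₃, g₁ = 1 ∨ h = 1 ∨ g₃ = 1 → ι₂ g₁ h g₃ = 1
  ι₃_norm : ∀ g₁ g₂ h, g₁ = 1 ∨ g₂ = 1 ∨ h = 1 → ι₃ g₁ g₂ h = 1
  /-- `• ⊗ • ⊗ • ⊗ •` -/
  α₀_cocycle : ∀ g₁ g₂ g₃ g₄,
    α₀ g₂ g₃ g₄ * (α₀ (g₁ * g₂) g₃ g₄)⁻¹ * α₀ g₁ (g₂ * g₃) g₄ * (α₀ g₁ g₂ (g₃ * g₄))⁻¹ *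
      α₀ g₁ g₂ g₃ = 1
  /-- `→ → → →` -/
  α₁_cocycle : ∀ h₁ h₂ h₃ h₄,
    α₁ h₂ h₃ h₄ * (α₁ (h₁ * h₂) h₃ h₄)⁻¹ * α₁ h₁ (h₂ * h₃) h₄ * (α₁ h₁ h₂ (h₃ * h₄))⁻¹ *
      α₁ h₁ h₂ h₃ = 1
  /-- `• ⊗ • ⊗ •`, first hexagon -/
  hexagon₁ : ∀ h₁ h₂ h₃,
    bracket α₁ [] [h₁, h₂] [h₁ * h₂] 1 *
        bracket α₁ [] [h₁ * h₂, h₃] [h₃, h₁ * h₂] (τ (h₁ * h₂) h₃) *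
        bracket α₁ [h₃] [h₁ * h₂] [h₁, h₂] 1 =
      bracket α₁ [h₁] [h₂, h₃] [h₃, h₂] (τ h₂ h₃) * bracket α₁ [] [h₁, h₃] [h₃, h₁] (τ h₁ h₃)
  /-- `• ⊗ • ⊗ •`, second hexagon -/
  hexagon₂ : ∀ h₁ h₂ h₃,
    toStructureMaps.MoveMul h₁ h₂ h₃ (τ h₁ (h₂ * h₃)) (τ h₁ h₂) (τ h₁ h₃)
  /-- `• ⊗ • ⊗ • ⊗ • ⊗ •` -/
  π_cocycle : ∀ g₁ g₂ g₃ g₄ g₅,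
    bracket α₁ [] [α₀ g₃ g₄ g₅, α₀ g₂ (g₃ * g₄) g₅, α₀ g₂ g₃ g₄]
          [α₀ g₂ g₃ (g₄ * g₅), α₀ (g₂ * g₃) g₄ g₅] (π g₂ g₃ g₄ g₅) *
        bracket α₁ [α₀ g₂ g₃ (g₄ * g₅)]
          [α₀ (g₂ * g₃) g₄ g₅, α₀ g₁ (g₂ * g₃ * g₄) g₅, α₀ g₁ (g₂ * g₃) g₄]
          [α₀ g₁ (g₂ * g₃) (g₄ * g₅), α₀ (g₁ * g₂ * g₃) g₄ g₅] (π g₁ (g₂ * g₃) g₄ g₅) *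
        bracket α₁ [α₀ g₂ g₃ (g₄ * g₅), α₀ g₁ (g₂ * g₃) (g₄ * g₅)]
          [α₀ (g₁ * g₂ * g₃) g₄ g₅, α₀ g₁ g₂ g₃]
          [α₀ g₁ g₂ g₃, α₀ (g₁ * g₂ * g₃) g₄ g₅] (ι₁ (α₀ g₁ g₂ g₃) g₄ g₅) *
        bracket α₁ [] [α₀ g₂ g₃ (g₄ * g₅), α₀ g₁ (g₂ * g₃) (g₄ * g₅), α₀ g₁ g₂ g₃]
          [α₀ g₁ g₂ (g₃ * g₄ * g₅), α₀ (g₁ * g₂) g₃ (g₄ * g₅)] (π g₁ g₂ g₃ (g₄ * g₅)) =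
      bracket α₁ [α₀ g₃ g₄ g₅, α₀ g₂ (g₃ * g₄) g₅]
          [α₀ g₂ g₃ g₄, α₀ g₁ (g₂ * g₃ * g₄) g₅]
          [α₀ g₁ (g₂ * g₃ * g₄) g₅, α₀ g₂ g₃ g₄] (ι₂ g₁ (α₀ g₂ g₃ g₄) g₅)⁻¹ *
        bracket α₁ [α₀ g₃ g₄ g₅, α₀ g₂ (g₃ * g₄) g₅, α₀ g₁ (g₂ * g₃ * g₄) g₅]
          [α₀ g₂ g₃ g₄, α₀ g₁ (g₂ * g₃) g₄, α₀ g₁ g₂ g₃]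
          [α₀ g₁ g₂ (g₃ * g₄), α₀ (g₁ * g₂) g₃ g₄] (π g₁ g₂ g₃ g₄) *
        bracket α₁ [α₀ g₃ g₄ g₅]
          [α₀ g₂ (g₃ * g₄) g₅, α₀ g₁ (g₂ * g₃ * g₄) g₅, α₀ g₁ g₂ (g₃ * g₄)]
          [α₀ g₁ g₂ (g₃ * g₄ * g₅), α₀ (g₁ * g₂) (g₃ * g₄) g₅] (π g₁ g₂ (g₃ * g₄) g₅) *
        bracket α₁ [] [α₀ g₃ g₄ g₅, α₀ g₁ g₂ (g₃ * g₄ * g₅)]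
          [α₀ g₁ g₂ (g₃ * g₄ * g₅), α₀ g₃ g₄ g₅] (ι₃ g₁ g₂ (α₀ g₃ g₄ g₅))⁻¹ *
        bracket α₁ [α₀ g₁ g₂ (g₃ * g₄ * g₅)]
          [α₀ g₃ g₄ g₅, α₀ (g₁ * g₂) (g₃ * g₄) g₅, α₀ (g₁ * g₂) g₃ g₄]
          [α₀ (g₁ * g₂) g₃ (g₄ * g₅), α₀ (g₁ * g₂ * g₃) g₄ g₅] (π (g₁ * g₂) g₃ g₄ g₅)
  /-- `→ ⊗ • ⊗ • ⊗ •` -/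
  cube₁ : ∀ g₁ g₂ g₃ g₄ h, toStructureMaps.PentagonCube g₁ g₂ g₃ g₄ h
    (ι₁ h g₂ g₃) (ι₁ h (g₂ * g₃) g₄) (τ h (α₀ g₂ g₃ g₄))⁻¹ (ι₁ h g₃ g₄) (ι₁ h g₂ (g₃ * g₄))
  /-- `• ⊗ → ⊗ • ⊗ •` -/
  cube₂ : ∀ g₁ g₂ g₃ g₄ h, toStructureMaps.PentagonCube g₁ g₂ g₃ g₄ h
    (ι₂ g₁ h g₃) (ι₂ g₁ h g₄) (ι₁ h g₃ g₄) (ι₁ h g₃ g₄) (ι₂ g₁ h (g₃ * g₄))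
  /-- `• ⊗ • ⊗ → ⊗ •` -/
  cube₃ : ∀ g₁ g₂ g₃ g₄ h, toStructureMaps.PentagonCube g₁ g₂ g₃ g₄ h
    (ι₃ g₁ g₂ h) (ι₂ g₁ h g₄) (ι₂ g₂ h g₄) (ι₂ (g₁ * g₂) h g₄) (ι₃ g₁ g₂ h)
  /-- `• ⊗ • ⊗ • ⊗ →` -/
  cube₄ : ∀ g₁ g₂ g₃ g₄ h, toStructureMaps.PentagonCube g₁ g₂ g₃ g₄ h
    (τ (α₀ g₁ g₂ g₃) h) (ι₃ g₁ (g₂ * g₃) h) (ι₃ g₂ g₃ h) (ι₃ (g₁ * g₂) g₃ h) (ι₃ g₁ g₂ h)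
  /-- `→ → ⊗ • ⊗ •` -/
  ι₁_mul : ∀ g₁ g₂ g₃ h₁ h₂, toStructureMaps.MoveMul (α₀ g₁ g₂ g₃) h₁ h₂
    (ι₁ (h₁ * h₂) g₂ g₃) (ι₁ h₁ g₂ g₃) (ι₁ h₂ g₂ g₃)
  /-- `• ⊗ → → ⊗ •` -/
  ι₂_mul : ∀ g₁ g₂ g₃ h₁ h₂, toStructureMaps.MoveMul (α₀ g₁ g₂ g₃) h₁ h₂
    (ι₂ g₁ (h₁ * h₂) g₃) (ι₂ g₁ h₁ g₃) (ι₂ g₁ h₂ g₃)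
  /-- `• ⊗ • ⊗ → →` -/
  ι₃_mul : ∀ g₁ g₂ g₃ h₁ h₂, toStructureMaps.MoveMul (α₀ g₁ g₂ g₃) h₁ h₂
    (ι₃ g₁ g₂ (h₁ * h₂)) (ι₃ g₁ g₂ h₁) (ι₃ g₁ g₂ h₂)

/-! ## 2-equivalence -/

/-- The data of a 2-equivalence. As 2-morphisms between words, with bars for the automorphisms and
primes for the second structure: `μ h₁ h₂` goes from the bar of `h₁h₂` to the composite of the bars;
`φ g₁ g₂ g₃` goes from `[bar (α₀ g₁ g₂ g₃), Φ (g₁g₂) g₃, Φ g₁ g₂]` to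
`[Φ g₁ (g₂g₃), Φ g₂ g₃, α₀' ḡ₁ ḡ₂ ḡ₃]`; `ψ h g₂` goes from `[Φ g₁ g₂, h̄]` to `[h̄, Φ g₁ g₂]` for `h`
acting on the first factor, and `χ g₁ h` likewise for `h` acting on the second factor. -/
structure EquivalenceMaps (G H R : Type*) [Group G] [CommGroup H] [CommRing R] [StarRing R] where
  /-- the automorphism of `G` -/
  gAut : G ≃* G
  /-- the automorphism of `H` -/
  hAut : H ≃* H
  /-- the automorphism of the ring with involution `R` -/
  rAut : R ≃⋆+* R
  μ : H → H → Rˣ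
  Φ : G → G → H
  φ : G → G → G → Rˣ
  ψ : H → G → Rˣ
  χ : G → H → Rˣ

namespace EquivalenceMaps

variable {G H R : Type*} [Group G] [CommGroup H] [CommRing R] [StarRing R]

/-- The automorphism of `R` on invertible elements. -/
def uAut (E : EquivalenceMaps G H R) : Rˣ ≃* Rˣ :=
  Units.mapEquiv E.rAut.toRingEquiv.toMulEquiv

/-- Auxiliary recursion for `muWord`; `p` is the product of the letters already absorbed. -/
def muWordAux (E : EquivalenceMaps G H R) : H → List H → Rˣ
  | _, [] => 1
  | p, x :: w => E.μ p x * E.muWordAux (p * x) w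

/-- The string of maps `μ` from the bar of `(x₁ x₂ …) xₙ` to the composite of the bars, both
parenthesized from left to right. -/
def muWord (E : EquivalenceMaps G H R) (w : List H) : Rˣ :=
  E.muWordAux 1 w

/-- The bracket, with respect to the 1-associator `α'` of the second structure, of the image of a
2-morphism `r : u ⇒ v` of the first structure, applied after the word `A`. The maps `μ` are
absorbed, so that it is a 2-morphism between words of barred letters. -/
def barBracket (E : EquivalenceMaps G H R) (α' : H → H → H → Rˣ) (A u v : List H) (r : Rˣ) : Rˣ :=
  bracket α' A (u.map E.hAut) (v.map E.hAut) ((E.muWord u)⁻¹ * E.uAut r * E.muWord v)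

/-- Naturality of `φ g₁ g₂ g₃` with respect to an endomorphism `h` of one of the factors: the two
composites from `[ᾱ, Φ (g₁g₂) g₃, Φ g₁ g₂, h̄]` to `[h̄, Φ g₁ (g₂g₃), Φ g₂ g₃, α']` agree. The scalars
`s₁, s₂` move `h̄` past `Φ g₁ g₂, Φ (g₁g₂) g₃`; `r` moves `h` past the 0-associator in the first
structure; and `t₁, t₂, t₃` move `h̄` past `α', Φ g₂ g₃, Φ g₁ (g₂g₃)`. -/
def Prism (E : EquivalenceMaps G H R) (S S' : StructureMaps G H R) (g₁ g₂ g₃ : G) (h : H)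
    (s₁ s₂ r t₁ t₂ t₃ : Rˣ) : Prop :=
  let br := bracket S'.α₁
  let b := E.hAut h
  let a := S.α₀ g₁ g₂ g₃
  let a' := S'.α₀ (E.gAut g₁) (E.gAut g₂) (E.gAut g₃)
  let u := [E.hAut a, E.Φ (g₁ * g₂) g₃, E.Φ g₁ g₂]
  let v := [E.Φ g₁ (g₂ * g₃), E.Φ g₂ g₃, a']
  br [E.hAut a, E.Φ (g₁ * g₂) g₃] [E.Φ g₁ g₂, b] [b, E.Φ g₁ g₂] s₁ *
      br [E.hAut a] [E.Φ (g₁ * g₂) g₃, b] [b, E.Φ (g₁ * g₂) g₃] s₂ *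
      E.barBracket S'.α₁ [] [a, h] [h, a] r * br [b] u v (E.φ g₁ g₂ g₃) =
    br [] u v (E.φ g₁ g₂ g₃) *
      br [E.Φ g₁ (g₂ * g₃), E.Φ g₂ g₃] [a', b] [b, a'] t₁ *
      br [E.Φ g₁ (g₂ * g₃)] [E.Φ g₂ g₃, b] [b, E.Φ g₂ g₃] t₂ *
      br [] [E.Φ g₁ (g₂ * g₃), b] [b, E.Φ g₁ (g₂ * g₃)] t₃

/-- Multiplicativity of a move of barred letters past `f`. -/
def BarMoveMul (E : EquivalenceMaps G H R) (S' : StructureMaps G H R) (f h₁ h₂ : H)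
    (t t₁ t₂ : Rˣ) : Prop :=
  let br := bracket S'.α₁
  E.barBracket S'.α₁ [f] [h₁, h₂] [h₁ * h₂] 1 *
      br [] [f, E.hAut (h₁ * h₂)] [E.hAut (h₁ * h₂), f] t *
      E.barBracket S'.α₁ [] [h₁ * h₂] [h₁, h₂] 1 =
    br [] [f, E.hAut h₁] [E.hAut h₁, f] t₁ * br [E.hAut h₁] [f, E.hAut h₂] [E.hAut h₂, f] t₂

/-- The compatibility of `φ` with the two pentagonators. Both sides are composites from
`[x̄, ȳ, z̄, Φ (g₁g₂g₃) g₄, Φ (g₁g₂) g₃, Φ g₁ g₂]` to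
`[Φ g₁ (g₂g₃g₄), Φ g₂ (g₃g₄), Φ g₃ g₄, p', q']`. -/
def PentagonCondition (E : EquivalenceMaps G H R) (S S' : StructureMaps G H R)
    (g₁ g₂ g₃ g₄ : G) : Prop :=
  let br := bracket S'.α₁
  let bar := E.hAut
  let x := S.α₀ g₂ g₃ g₄
  let y := S.α₀ g₁ (g₂ * g₃) g₄
  let z := S.α₀ g₁ g₂ g₃
  let p := S.α₀ g₁ g₂ (g₃ * g₄)
  let q := S.α₀ (g₁ * g₂) g₃ g₄
  let k₁ := E.gAut g₁
  let k₂ := E.gAut g₂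
  let k₃ := E.gAut g₃
  let k₄ := E.gAut g₄
  let x' := S'.α₀ k₂ k₃ k₄
  let y' := S'.α₀ k₁ (k₂ * k₃) k₄
  let z' := S'.α₀ k₁ k₂ k₃
  let p' := S'.α₀ k₁ k₂ (k₃ * k₄)
  let q' := S'.α₀ (k₁ * k₂) k₃ k₄
  let F12 := E.Φ g₁ g₂
  let F23 := E.Φ g₂ g₃
  let F34 := E.Φ g₃ g₄
  let F12_3 := E.Φ (g₁ * g₂) g₃
  let F1_23 := E.Φ g₁ (g₂ * g₃)
  let F23_4 := E.Φ (g₂ * g₃) g₄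
  let F2_34 := E.Φ g₂ (g₃ * g₄)
  let F12_34 := E.Φ (g₁ * g₂) (g₃ * g₄)
  let F123_4 := E.Φ (g₁ * g₂ * g₃) g₄
  let F1_234 := E.Φ g₁ (g₂ * g₃ * g₄)
  br [bar x, bar y] [bar z, F123_4] [F123_4, bar z] (E.ψ z g₄)⁻¹ *
      br [bar x, bar y, F123_4] [bar z, F12_3, F12] [F1_23, F23, z'] (E.φ g₁ g₂ g₃) *
      br [bar x] [bar y, F123_4, F1_23] [F1_234, F23_4, y'] (E.φ g₁ (g₂ * g₃) g₄) *
      br [bar x, F1_234, F23_4] [y', F23] [F23, y'] (S'.ι₂ k₁ F23 k₄) *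
      br [] [bar x, F1_234] [F1_234, bar x] (E.χ g₁ x)⁻¹ *
      br [F1_234] [bar x, F23_4, F23] [F2_34, F34, x'] (E.φ g₂ g₃ g₄) *
      br [F1_234, F2_34, F34] [x', y', z'] [p', q'] (S'.π k₁ k₂ k₃ k₄) =
    E.barBracket S'.α₁ [] [x, y, z] [p, q] (S.π g₁ g₂ g₃ g₄) *
      br [bar p] [bar q, F123_4, F12_3] [F12_34, F34, q'] (E.φ (g₁ * g₂) g₃ g₄) *
      br [bar p, F12_34, F34] [q', F12] [F12, q'] (S'.ι₁ F12 k₃ k₄) *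
      br [bar p, F12_34] [F34, F12] [F12, F34] (S'.τ F12 F34)⁻¹ *
      br [] [bar p, F12_34, F12] [F1_234, F2_34, p'] (E.φ g₁ g₂ (g₃ * g₄)) *
      br [F1_234, F2_34] [p', F34] [F34, p'] (S'.ι₃ k₁ k₂ F34)

end EquivalenceMaps

/-- A 2-equivalence from the structure `S` to the structure `S'`. -/
structure TwoEquivalence {G H R : Type*} [Group G] [CommGroup H] [CommRing R] [StarRing R]
    (S S' : SemiWeakStructure G H R) extends EquivalenceMaps G H R where
  μ_norm : ∀ h₁ h₂, h₁ = 1 ∨ h₂ = 1 → μ h₁ h₂ = 1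
  Φ_norm : ∀ g₁ g₂, g₁ = 1 ∨ g₂ = 1 → Φ g₁ g₂ = 1
  φ_norm : ∀ g₁ g₂ g₃, g₁ = 1 ∨ g₂ = 1 ∨ g₃ = 1 → φ g₁ g₂ g₃ = 1
  ψ_norm : ∀ h g, h = 1 ∨ g = 1 → ψ h g = 1
  χ_norm : ∀ g h, g = 1 ∨ h = 1 → χ g h = 1
  cond_α₀ : ∀ g₁ g₂ g₃,
    hAut (S.α₀ g₁ g₂ g₃) * Φ (g₁ * g₂) g₃ * Φ g₁ g₂ =
      Φ g₁ (g₂ * g₃) * Φ g₂ g₃ * S'.α₀ (gAut g₁) (gAut g₂) (gAut g₃)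
  cond_α₁ : ∀ h₁ h₂ h₃,
    toEquivalenceMaps.uAut (S.α₁ h₁ h₂ h₃) * μ (h₁ * h₂) h₃ * μ h₁ h₂ =
      μ h₁ (h₂ * h₃) * μ h₂ h₃ * S'.α₁ (hAut h₁) (hAut h₂) (hAut h₃)
  cond_τ : ∀ h₁ h₂,
    toEquivalenceMaps.barBracket S'.α₁ [] [h₁, h₂] [h₂, h₁] (S.τ h₁ h₂) =
      bracket S'.α₁ [] [hAut h₁, hAut h₂] [hAut h₂, hAut h₁] (S'.τ (hAut h₁) (hAut h₂))
  cond_ι₁ : ∀ g₁ g₂ g₃ h, toEquivalenceMaps.Prism S.toStructureMaps S'.toStructureMaps g₁ g₂ g₃ h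
    (ψ h g₂) (ψ h g₃) (S.ι₁ h g₂ g₃)
    (S'.ι₁ (hAut h) (gAut g₂) (gAut g₃)) (S'.τ (hAut h) (Φ g₂ g₃))⁻¹ (ψ h (g₂ * g₃))
  cond_ι₂ : ∀ g₁ g₂ g₃ h, toEquivalenceMaps.Prism S.toStructureMaps S'.toStructureMaps g₁ g₂ g₃ h
    (χ g₁ h) (ψ h g₃) (S.ι₂ g₁ h g₃)
    (S'.ι₂ (gAut g₁) (hAut h) (gAut g₃)) (ψ h g₃) (χ g₁ h)
  cond_ι₃ : ∀ g₁ g₂ g₃ h, toEquivalenceMaps.Prism S.toStructureMaps S'.toStructureMaps g₁ g₂ g₃ h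
    (S'.τ (Φ g₁ g₂) (hAut h)) (χ (g₁ * g₂) h) (S.ι₃ g₁ g₂ h)
    (S'.ι₃ (gAut g₁) (gAut g₂) (hAut h)) (χ g₂ h) (χ g₁ h)
  ψ_mul : ∀ g₁ g₂ h₁ h₂, toEquivalenceMaps.BarMoveMul S'.toStructureMaps (Φ g₁ g₂) h₁ h₂
    (ψ (h₁ * h₂) g₂) (ψ h₁ g₂) (ψ h₂ g₂)
  χ_mul : ∀ g₁ g₂ h₁ h₂, toEquivalenceMaps.BarMoveMul S'.toStructureMaps (Φ g₁ g₂) h₁ h₂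
    (χ g₁ (h₁ * h₂)) (χ g₁ h₁) (χ g₁ h₂)
  cond_π : ∀ g₁ g₂ g₃ g₄,
    toEquivalenceMaps.PentagonCondition S.toStructureMaps S'.toStructureMaps g₁ g₂ g₃ g₄

/-! ## Triangulated closed oriented PL 4-manifolds -/

/-- The link of a vertex. -/
def vertexLink {V : Type*} [DecidableEq V] (K : AbstractSimplicialComplex V) (v : V) :
    PreAbstractSimplicialComplex V where
  faces := {t | t.Nonempty ∧ v ∉ t ∧ insert v t ∈ K.faces}
  isRelLowerSet_faces := by
    rintro t ⟨hne, hv, hK⟩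
    refine ⟨hne, fun s hs hsne => ⟨hsne, fun h => hv (hs h), ?_⟩⟩
    exact (K.isRelLowerSet_faces hK).2 (Finset.insert_subset_insert v hs)
      (Finset.insert_nonempty v s)

/-- The boundary complex of the standard `n`-simplex. -/
def simplexBoundary (n : ℕ) : PreAbstractSimplicialComplex ℕ where
  faces := {t | t.Nonempty ∧ t ⊂ Finset.range (n + 1)}
  isRelLowerSet_faces := by
    rintro t ⟨hne, ht⟩
    exact ⟨hne, fun s hs hsne => ⟨hsne, lt_of_le_of_lt hs ht⟩⟩

/-- `L` is the stellar subdivision of `K` at the face `s` with the new vertex `a`: the open star of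
`s` is replaced by the join of `a`, the boundary of `s`, and the link of `s`. -/
def IsStarring (K L : PreAbstractSimplicialComplex ℕ) (s : Finset ℕ) (a : ℕ) : Prop :=
  s ∈ K.faces ∧ {a} ∉ K.faces ∧
    ∀ t, t ∈ L.faces ↔
      (t ∈ K.faces ∧ ¬ s ⊆ t) ∨ ∃ u, t = insert a u ∧ ¬ s ⊆ u ∧ u ∪ s ∈ K.faces

/-- Stellar equivalence: the equivalence relation generated by stellar subdivisions. For finite
complexes it is the relation of PL homeomorphism. -/
def StellarEquivalent : PreAbstractSimplicialComplex ℕ → PreAbstractSimplicialComplex ℕ → Prop :=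
  Relation.EqvGen fun K L => ∃ s a, IsStarring K L s a

/-- `K` is a combinatorial (PL) `n`-sphere. -/
def IsCombinatorialSphere {V : Type*} (n : ℕ) (K : PreAbstractSimplicialComplex V) : Prop :=
  ∃ f : V → ℕ, Function.Injective f ∧ StellarEquivalent (K.map f) (simplexBoundary (n + 1))

/-- The `n`-simplices of a simplicial complex. -/
abbrev KSimplex {V : Type*} (K : AbstractSimplicialComplex V) (n : ℕ) : Type _ :=
  {s : Finset V // s ∈ K.faces ∧ s.card = n + 1}

/-- The tuple `v` enumerates the vertices of a 4-simplex of `K`. -/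
def Enumerates {V : Type*} [DecidableEq V] (K : AbstractSimplicialComplex V) (v : Fin 5 → V) :
    Prop :=
  Function.Injective v ∧ Finset.univ.image v ∈ K.faces

/-- A closed oriented PL 4-manifold with a triangulation on the finite vertex set `V`: an abstract
simplicial complex in which the link of every vertex is a combinatorial 3-sphere, together with an
orientation. The value `orient v` is `1` if the ordered 4-simplex `v` is positively oriented and
`-1` if not; two different 4-simplices with a common tetrahedron induce opposite orientations on
it. -/
structure TriangulatedFourManifold (V : Type*) [Fintype V] [DecidableEq V] where
  complex : AbstractSimplicialComplex V
  link_sphere : ∀ v : V, IsCombinatorialSphere 3 (vertexLink complex v)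
  orient : (Fin 5 → V) → ℤˣ
  orient_perm : ∀ v, Enumerates complex v → ∀ σ : Equiv.Perm (Fin 5),
    orient (v ∘ σ) = Equiv.Perm.sign σ * orient v
  orient_coherent : ∀ v w, Enumerates complex v → Enumerates complex w →
    (∀ i : Fin 4, v i.succ = w i.succ) → v 0 ≠ w 0 → orient w = - orient v

/-! ## The state-sum -/

section StateSum

variable {G H R V : Type*} [Group G] [CommGroup H] [CommRing R]

/-- A labelling of the edges by `G` and of the triangles by `H`. -/
abbrev Labelling (G H : Type*) {V : Type*} (K : AbstractSimplicialComplex V) : Type _ :=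
  (KSimplex K 1 → G) × (KSimplex K 2 → H)

open Classical in
/-- The label `g_{ij}` of the edge `(ij)`. -/
noncomputable def Labelling.g {K : AbstractSimplicialComplex V} (l : Labelling G H K)
    (i j : V) : G :=
  if h : ({i, j} : Finset V) ∈ K.faces ∧ ({i, j} : Finset V).card = 1 + 1 then l.1 ⟨{i, j}, h⟩
  else 1

open Classical in
/-- The label `h_{ijk}` of the triangle `(ijk)`. -/
noncomputable def Labelling.h {K : AbstractSimplicialComplex V} (l : Labelling G H K)
    (i j k : V) : H :=
  if h : ({i, j, k} : Finset V) ∈ K.faces ∧ ({i, j, k} : Finset V).card = 2 + 1 then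
    l.2 ⟨{i, j, k}, h⟩
  else 1

/-- The local semi-flatness conditions. -/
def IsSemiFlat [LinearOrder V] (S : StructureMaps G H R) {K : AbstractSimplicialComplex V}
    (l : Labelling G H K) : Prop :=
  (∀ i j k : V, i < j → j < k → {i, j, k} ∈ K.faces →
    l.g i j * (l.g i k)⁻¹ * l.g j k = 1) ∧
  ∀ i j k m : V, i < j → j < k → k < m → {i, j, k, m} ∈ K.faces →
    l.h j k m * (l.h i k m)⁻¹ * l.h i j m * (l.h i j k)⁻¹ = S.α₀ (l.g k m) (l.g j k) (l.g i j)

/-- The labellings over which the state-sum is taken. -/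
abbrev FlatLabelling [LinearOrder V] (S : StructureMaps G H R) (K : AbstractSimplicialComplex V) :
    Type _ :=
  {l : Labelling G H K // IsSemiFlat S l}

noncomputable instance [Finite V] (K : AbstractSimplicialComplex V) (n : ℕ) :
    Fintype (KSimplex K n) :=
  Fintype.ofFinite _

noncomputable instance [Finite G] [Finite H] [Finite V] [LinearOrder V] (S : StructureMaps G H R)
    (K : AbstractSimplicialComplex V) : Fintype (FlatLabelling S K) :=
  Fintype.ofFinite _

/-- The partition function `Z((ijklm))` for `i < j < k < l < m`: the scalar of the composite of the
five bracketed 2-morphisms `(ι₃)⁻¹`, `τ`, `(ι₁)⁻¹`, `ι₂`, `π`, in this order, from the word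
`[h_{ilm}, h_{ikl}, h_{ijk}, α₀ a b (cd), α₀ (ab) c d]` to itself. Between them, the five identities
`h_{ikl} h_{ijk} α₀ = h_{ijl} h_{jkl}` of the tetrahedra, one for each, rewrite the words. -/
noncomputable def partitionFunction (S : StructureMaps G H R) {K : AbstractSimplicialComplex V}
    (L : Labelling G H K) (i j k l m : V) : Rˣ :=
  let br := bracket S.α₁
  let a := L.g l m
  let b := L.g k l
  let c := L.g j k
  let d := L.g i j
  br [L.h i l m, L.h i k l] [L.h i j k, S.α₀ a b (c * d)] [S.α₀ a b (c * d), L.h i j k]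
      (S.ι₃ a b (L.h i j k))⁻¹ *
    br [] [L.h i l m, L.h i k l, S.α₀ a b (c * d)] [L.h i k m, L.h k l m] 1 *
    br [L.h i k m] [L.h k l m, L.h i j k] [L.h i j k, L.h k l m] (S.τ (L.h k l m) (L.h i j k)) *
    br [L.h i k m, L.h i j k] [L.h k l m, S.α₀ (a * b) c d] [S.α₀ (a * b) c d, L.h k l m]
      (S.ι₁ (L.h k l m) c d)⁻¹ *
    br [] [L.h i k m, L.h i j k, S.α₀ (a * b) c d] [L.h i j m, L.h j k m] 1 *
    br [L.h i j m] [L.h j k m, L.h k l m] [L.h j l m, L.h j k l, S.α₀ a b c] 1 *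
    br [] [L.h i j m, L.h j l m] [L.h i l m, L.h i j l, S.α₀ a (b * c) d] 1 *
    br [L.h i l m, L.h i j l] [S.α₀ a (b * c) d, L.h j k l] [L.h j k l, S.α₀ a (b * c) d]
      (S.ι₂ a (L.h j k l) d) *
    br [L.h i l m] [L.h i j l, L.h j k l] [L.h i k l, L.h i j k, S.α₀ b c d] 1 *
    br [L.h i l m, L.h i k l, L.h i j k] [S.α₀ b c d, S.α₀ a (b * c) d, S.α₀ a b c]
      [S.α₀ a b (c * d), S.α₀ (a * b) c d] (S.π a b c d)

/-- The vertices of a 4-simplex in increasing order. -/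
def orderedVertices [LinearOrder V] {K : AbstractSimplicialComplex V} (s : KSimplex K 4) :
    Fin 5 → V :=
  s.1.orderEmbOfFin s.2.2

/-- `Z(S, ℓ)` for the 4-simplex `s`. -/
noncomputable def simplexWeight [LinearOrder V] (S : StructureMaps G H R)
    {K : AbstractSimplicialComplex V} (L : Labelling G H K) (s : KSimplex K 4) : Rˣ :=
  partitionFunction S L (orderedVertices s 0) (orderedVertices s 1) (orderedVertices s 2)
    (orderedVertices s 3) (orderedVertices s 4)

/-- The state-sum
`Z(M, T) = (#G)^(-v₀) (#H)^(v₀ - v₁) ∑_ℓ ∏_s Z(s, ℓ)^ε(s)`, for `#G` and `#H` invertible in `R`. -/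
noncomputable def stateSum [Finite G] [Finite H] [Fintype V] [LinearOrder V]
    (hG : IsUnit (Nat.card G : R)) (hH : IsUnit (Nat.card H : R))
    (S : SemiWeakStructure G H R) (T : TriangulatedFourManifold V) : R :=
  let v₀ : ℤ := Nat.card (KSimplex T.complex 0)
  let v₁ : ℤ := Nat.card (KSimplex T.complex 1)
  ((hG.unit ^ (-v₀) * hH.unit ^ (v₀ - v₁) : Rˣ) : R) *
    ∑ L : FlatLabelling S.toStructureMaps T.complex,
      ((∏ s : KSimplex T.complex 4,
        simplexWeight S.toStructureMaps L.1 s ^ ((T.orient (orderedVertices s) : ℤˣ) : ℤ) : Rˣ) : R)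

end StateSum

/-! The strategy is to relabel. A labelling `(g, h)` for the first structure is sent to the edge
labels `ḡ` and the triangle labels `h̄ᵢⱼₖ Φ(gⱼₖ, gᵢⱼ)`. The condition on `α₀` makes this a bijection of
flat labellings (`TwoEquivalence.isSemiFlat_relabel`), so the two state-sums can be compared term by
term. For a 4-simplex, the scalar of the new labelling is the bar of the scalar of the old one times
the product, with the signs of the boundary, of one scalar for each of the five tetrahedra
(`TwoEquivalence.simplexScalar_newLabel`). This scalar, `TwoEquivalence.defect`, depends only on the
labels of the tetrahedron. In a closed oriented manifold the contributions of the tetrahedra cancel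
(`prod_boundary`).

The local identity is a pasting of coherence diagrams. Two observations turn it into linear algebra.
The bracket of a scalar depends on the letters to the left of the subword only through their product
`x`. As a function of `x` it behaves like a 2-morphism of a strict monoidal 2-category: whiskering on
the left is a translation of `x`, because the reassociations of the whole word telescope by the
cocycle condition (`cellAt_mul`), and whiskering on the right does nothing. So every coherence
condition holds at every position, and 1-associators need not be tracked any more. Similarly, the bar
of a bracket of the first structure is a bracket of the second one, up to telescoping factors `μ`
(`EquivalenceMaps.uAut_bracket`). Inserting the defects, splitting the moves of the new labels by
multiplicativity and by the hexagons, and using the conditions on `φ`, `ψ`, `χ` at the positions that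
occur in the diagram, the identity becomes a linear combination of instances of the axioms. One
relation in it is not among the axioms: a letter that passes `Φ` by `ψ` and one that passes it by `χ`
can be exchanged by the tensorator before or after the passage (`SemiWeakStructure.moveAt_exchange`).

The cancellation needs that no tetrahedron lies in exactly one 4-simplex. Being a cycle modulo 2 of
the top dimension is invariant under stellar subdivision and its inverse
(`IsStarring.isEvenCycle_iff`) and holds for the boundary of a simplex, hence for the vertex links.
So each tetrahedron lies in an even number of 4-simplices, and since any two of them induce opposite
orientations, in none or in two. -/

/-! ### Bracketed scalars at a position -/

section Cells

variable {H K : Type*} [Monoid H] [CommGroup K]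

/-- The bracket `⌈r⌉` of `r : u ⇒ v` as a function of the product `x` of the letters to the left of
the subword. Whiskering on the left becomes a translation of `x`, whiskering on the right does
nothing. -/
def cellAt (α : H → H → H → K) (x : H) (u v : List H) (r : K) : K :=
  (reassoc α x u)⁻¹ * r * reassoc α x v

/-- The bracket of a scalar that moves the letter `h` to the left past the letter `a`. -/
def moveAt (α : H → H → H → K) (x a h : H) (t : K) : K :=
  cellAt α x [a, h] [h, a] t

/-- The identity 2-morphism from the letter `h₁h₂` to the word `[h₁, h₂]`. -/
def splitAt (α : H → H → H → K) (x h₁ h₂ : H) : K :=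
  cellAt α x [h₁ * h₂] [h₁, h₂] 1

theorem bracket_eq_cellAt (α : H → H → H → K) (A u v : List H) (r : K) :
    bracket α A u v r = cellAt α A.prod u v r := rfl

theorem cellAt_inv (α : H → H → H → K) (x : H) (u v : List H) (r : K) :
    cellAt α x u v r⁻¹ = (cellAt α x v u r)⁻¹ := by
  simp only [cellAt, mul_inv, inv_inv]
  rw [mul_comm, mul_comm (reassoc α x u)⁻¹, ← mul_assoc]

theorem cellAt_one_symm (α : H → H → H → K) (x : H) (u v : List H) :
    cellAt α x u v 1 = (cellAt α x v u 1)⁻¹ := by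
  rw [← cellAt_inv, inv_one]

theorem cellAt_trans (α : H → H → H → K) (x : H) (u v w : List H) (r s : K) :
    cellAt α x u v r * cellAt α x v w s = cellAt α x u w (r * s) := by
  simp only [cellAt, mul_assoc, mul_inv_cancel_left]

theorem reassocAux_append (α : H → H → H → K) (a p : H) (u v : List H) :
    reassocAux α a p (u ++ v) = reassocAux α a p u * reassocAux α a (p * u.prod) v := by
  induction u generalizing p with
  | nil => simp [reassocAux]
  | cons x u ih => simp [reassocAux, ih, mul_assoc]

/-- The pentagon identity for `α`, summed along a word. -/
theorem reassocAux_mul {α : H → H → H → K}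
    (hα : ∀ h₁ h₂ h₃ h₄, α h₂ h₃ h₄ * (α (h₁ * h₂) h₃ h₄)⁻¹ * α h₁ (h₂ * h₃) h₄ *
      (α h₁ h₂ (h₃ * h₄))⁻¹ * α h₁ h₂ h₃ = 1)
    (x y p : H) (u : List H) :
    reassocAux α (x * y) p u * α x y (p * u.prod) =
      reassocAux α y p u * reassocAux α x (y * p) u * α x y p := by
  induction u generalizing p with
  | nil => simp [reassocAux]
  | cons z u ih =>
    have h := congrArg Additive.ofMul (hα x y p z)
    have e := congrArg Additive.ofMul (ih (p * z))
    apply Additive.ofMul.injective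
    simp only [reassocAux, List.prod_cons, ofMul_mul, ofMul_inv, ofMul_one, mul_assoc] at h e ⊢
    linear_combination (norm := abel) e - h

/-- Left whiskering: a bracket at a translated position differs from the bracket in the untranslated
word only by the reassociations of the whole words, which telescope in a composite. -/
theorem cellAt_mul {α : H → H → H → K}
    (hα : ∀ h₁ h₂ h₃ h₄, α h₂ h₃ h₄ * (α (h₁ * h₂) h₃ h₄)⁻¹ * α h₁ (h₂ * h₃) h₄ *
      (α h₁ h₂ (h₃ * h₄))⁻¹ * α h₁ h₂ h₃ = 1)
    {x y : H} (A u v B : List H) (r : K) (huv : u.prod = v.prod) (hy : y = x * A.prod) :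
    cellAt α y u v r =
      (reassoc α x (A ++ (u ++ B)))⁻¹ * bracket α A u v r * reassoc α x (A ++ (v ++ B)) := by
  subst hy
  have hu := congrArg Additive.ofMul (reassocAux_mul hα x A.prod 1 u)
  have hv := congrArg Additive.ofMul (reassocAux_mul hα x A.prod 1 v)
  apply Additive.ofMul.injective
  simp only [cellAt, bracket, reassoc, reassocAux_append, ofMul_mul, ofMul_inv, one_mul, mul_one,
    huv] at hu hv ⊢
  linear_combination (norm := abel) hv - hu

theorem cellAt_append (α : H → H → H → K) (x : H) (u v B : List H) (r : K)
    (huv : u.prod = v.prod) : cellAt α x (u ++ B) (v ++ B) r = cellAt α x u v r := by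
  apply Additive.ofMul.injective
  simp only [cellAt, reassoc, reassocAux_append, huv, ofMul_mul, ofMul_inv]
  abel

end Cells

/-! ### The action of the automorphisms on brackets -/

section Bar

variable {G H R : Type*} [Group G] [CommGroup H] [CommRing R] [StarRing R]

namespace EquivalenceMaps

/-- `barBracket` as a function of the product `x` of the letters to the left of the subword. -/
def barAt (E : EquivalenceMaps G H R) (α' : H → H → H → Rˣ) (x : H) (u v : List H) (r : Rˣ) : Rˣ :=
  cellAt α' x (u.map E.hAut) (v.map E.hAut) ((E.muWord u)⁻¹ * E.uAut r * E.muWord v)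

theorem barBracket_eq_barAt (E : EquivalenceMaps G H R) (α' : H → H → H → Rˣ) (A u v : List H)
    (r : Rˣ) : E.barBracket α' A u v r = E.barAt α' A.prod u v r := rfl

theorem muWordAux_append (E : EquivalenceMaps G H R) (p : H) (u v : List H) :
    E.muWordAux p (u ++ v) = E.muWordAux p u * E.muWordAux (p * u.prod) v := by
  induction u generalizing p with
  | nil => simp [muWordAux]
  | cons x u ih => simp [muWordAux, ih, mul_assoc]

theorem barAt_inv (E : EquivalenceMaps G H R) (α' : H → H → H → Rˣ) (x : H) (u v : List H)
    (r : Rˣ) : E.barAt α' x u v r⁻¹ = (E.barAt α' x v u r)⁻¹ := by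
  rw [barAt, barAt, ← cellAt_inv]
  congr 1
  rw [map_inv, mul_inv, mul_inv, inv_inv, mul_comm, mul_comm (E.muWord u)⁻¹, ← mul_assoc]

theorem barAt_one_symm (E : EquivalenceMaps G H R) (α' : H → H → H → Rˣ) (x : H) (u v : List H) :
    E.barAt α' x u v 1 = (E.barAt α' x v u 1)⁻¹ := by
  rw [← barAt_inv, inv_one]

theorem barAt_trans (E : EquivalenceMaps G H R) (α' : H → H → H → Rˣ) (x : H) (u v w : List H)
    (r s : Rˣ) :
    E.barAt α' x u v r * E.barAt α' x v w s = E.barAt α' x u w (r * s) := by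
  rw [barAt, barAt, barAt, cellAt_trans, map_mul]
  congr 1
  simp only [mul_assoc, mul_inv_cancel_left]

theorem prod_map_hAut (E : EquivalenceMaps G H R) (u : List H) :
    (u.map E.hAut).prod = E.hAut u.prod := (map_list_prod E.hAut u).symm

theorem barAt_append (E : EquivalenceMaps G H R) (α' : H → H → H → Rˣ) (x : H) (u v B : List H)
    (r : Rˣ) (huv : u.prod = v.prod) :
    E.barAt α' x (u ++ B) (v ++ B) r = E.barAt α' x u v r := by
  rw [barAt, barAt, ← cellAt_append α' x (u.map E.hAut) (v.map E.hAut) (B.map E.hAut) _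
    (by simp only [prod_map_hAut, huv]), List.map_append, List.map_append]
  congr 1
  apply Additive.ofMul.injective
  simp only [muWord, muWordAux_append, huv, ofMul_mul, ofMul_inv]
  abel

/-- The compatibility of `μ` with the two 1-associators, summed along a word. -/
theorem uAut_reassocAux (E : EquivalenceMaps G H R) {α α' : H → H → H → Rˣ}
    (hμ : ∀ h₁ h₂ h₃, E.uAut (α h₁ h₂ h₃) * E.μ (h₁ * h₂) h₃ * E.μ h₁ h₂ =
      E.μ h₁ (h₂ * h₃) * E.μ h₂ h₃ * α' (E.hAut h₁) (E.hAut h₂) (E.hAut h₃))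
    (y p : H) (u : List H) :
    E.uAut (reassocAux α y p u) * E.muWordAux (y * p) u * E.μ y p =
      reassocAux α' (E.hAut y) (E.hAut p) (u.map E.hAut) * E.muWordAux p u *
        E.μ y (p * u.prod) := by
  induction u generalizing p with
  | nil => simp [reassocAux, muWordAux]
  | cons z u ih =>
    have h := congrArg Additive.ofMul (hμ y p z)
    have e := congrArg Additive.ofMul (ih (p * z))
    apply Additive.ofMul.injective
    simp only [reassocAux, muWordAux, List.map_cons, List.prod_cons, map_mul, ofMul_mul,
      mul_assoc] at h e ⊢
    linear_combination (norm := abel) e + h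

/-- The bar of a bracket of the first structure is a bracket of the second one, up to the maps `μ`
of the whole words, which telescope in a composite. -/
theorem uAut_bracket (E : EquivalenceMaps G H R) {α α' : H → H → H → Rˣ}
    (hμ : ∀ h₁ h₂ h₃, E.uAut (α h₁ h₂ h₃) * E.μ (h₁ * h₂) h₃ * E.μ h₁ h₂ =
      E.μ h₁ (h₂ * h₃) * E.μ h₂ h₃ * α' (E.hAut h₁) (E.hAut h₂) (E.hAut h₃))
    {y : H} (A u v B : List H) (r : Rˣ) (huv : u.prod = v.prod) (hy : y = E.hAut A.prod) :
    E.uAut (bracket α A u v r) =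
      E.muWord (A ++ (u ++ B)) * E.barAt α' y u v r * (E.muWord (A ++ (v ++ B)))⁻¹ := by
  subst hy
  have hu := congrArg Additive.ofMul (E.uAut_reassocAux hμ A.prod 1 u)
  have hv := congrArg Additive.ofMul (E.uAut_reassocAux hμ A.prod 1 v)
  apply Additive.ofMul.injective
  simp only [bracket, barAt, cellAt, reassoc, muWord, muWordAux_append, ofMul_mul, ofMul_inv,
    map_mul, map_inv, map_one, one_mul, mul_one, huv] at hu hv ⊢
  linear_combination (norm := abel) hv - hu

end EquivalenceMaps

end Bar

/-! ### The coherence conditions at an arbitrary position -/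

section Conditions

variable {G H R : Type*} [Group G] [CommGroup H] [CommRing R]

namespace SemiWeakStructure

/-- The bracket of the pentagonator at the position `x`. -/
def piAt (S : SemiWeakStructure G H R) (x : H) (g₁ g₂ g₃ g₄ : G) : Rˣ :=
  cellAt S.α₁ x [S.α₀ g₂ g₃ g₄, S.α₀ g₁ (g₂ * g₃) g₄, S.α₀ g₁ g₂ g₃]
    [S.α₀ g₁ g₂ (g₃ * g₄), S.α₀ (g₁ * g₂) g₃ g₄] (S.π g₁ g₂ g₃ g₄)

theorem α₀_pentagon (S : SemiWeakStructure G H R) (g₁ g₂ g₃ g₄ : G) :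
    S.α₀ g₂ g₃ g₄ * S.α₀ g₁ (g₂ * g₃) g₄ * S.α₀ g₁ g₂ g₃ =
      S.α₀ g₁ g₂ (g₃ * g₄) * S.α₀ (g₁ * g₂) g₃ g₄ := by
  have h := congrArg Additive.ofMul (S.α₀_cocycle g₁ g₂ g₃ g₄)
  apply Additive.ofMul.injective
  simp only [ofMul_mul, ofMul_inv, ofMul_one] at h ⊢
  linear_combination (norm := abel) h

theorem moveAt_mul_right (S : SemiWeakStructure G H R) {a h₁ h₂ : H} {t t₁ t₂ : Rˣ}
    (h : S.MoveMul a h₁ h₂ t t₁ t₂) {x y z : H} (hy : y = x * a) (hz : z = x * h₁) :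
    moveAt S.α₁ x a (h₁ * h₂) t * splitAt S.α₁ x h₁ h₂ =
      splitAt S.α₁ y h₁ h₂ * moveAt S.α₁ x a h₁ t₁ * moveAt S.α₁ z a h₂ t₂ := by
  have e₁ := congrArg Additive.ofMul
    (cellAt_mul S.α₁_cocycle (x := x) (y := y) [a] [h₁ * h₂] [h₁, h₂] [] 1 (by simp) (by simpa))
  have e₂ := congrArg Additive.ofMul (cellAt_mul S.α₁_cocycle (x := x) (y := x)
    [] [a, h₁ * h₂] [h₁ * h₂, a] [] t (by simp [mul_comm]) (by simp))
  have e₃ := congrArg Additive.ofMul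
    (cellAt_mul S.α₁_cocycle (x := x) (y := x) [] [h₁ * h₂] [h₁, h₂] [a] 1 (by simp) (by simp))
  have e₄ := congrArg Additive.ofMul (cellAt_mul S.α₁_cocycle (x := x) (y := x)
    [] [a, h₁] [h₁, a] [h₂] t₁ (by simp [mul_comm]) (by simp))
  have e₅ := congrArg Additive.ofMul (cellAt_mul S.α₁_cocycle (x := x) (y := z)
    [h₁] [a, h₂] [h₂, a] [] t₂ (by simp [mul_comm]) (by simpa))
  have h' := congrArg Additive.ofMul h
  apply Additive.ofMul.injective
  simp only [bracket_eq_cellAt, cellAt_one_symm _ _ [h₁, h₂] [h₁ * h₂], moveAt, splitAt,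
    List.cons_append, List.nil_append, ofMul_mul, ofMul_inv] at *
  linear_combination (norm := abel) h' - e₁ + e₂ + e₃ - e₄ - e₅

theorem moveAt_mul_left (S : SemiWeakStructure G H R) (h₁ h₂ h₃ : H) {x y z : H}
    (hy : y = x * h₃) (hz : z = x * h₁) :
    moveAt S.α₁ x (h₁ * h₂) h₃ (S.τ (h₁ * h₂) h₃) * splitAt S.α₁ y h₁ h₂ =
      splitAt S.α₁ x h₁ h₂ * moveAt S.α₁ z h₂ h₃ (S.τ h₂ h₃) *
        moveAt S.α₁ x h₁ h₃ (S.τ h₁ h₃) := by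
  have e₁ := congrArg Additive.ofMul
    (cellAt_mul S.α₁_cocycle (x := x) (y := x) [] [h₁ * h₂] [h₁, h₂] [h₃] 1 (by simp) (by simp))
  have e₂ := congrArg Additive.ofMul (cellAt_mul S.α₁_cocycle (x := x) (y := x)
    [] [h₁ * h₂, h₃] [h₃, h₁ * h₂] [] (S.τ (h₁ * h₂) h₃) (by simp [mul_comm]) (by simp))
  have e₃ := congrArg Additive.ofMul
    (cellAt_mul S.α₁_cocycle (x := x) (y := y) [h₃] [h₁ * h₂] [h₁, h₂] [] 1 (by simp) (by simpa))
  have e₄ := congrArg Additive.ofMul (cellAt_mul S.α₁_cocycle (x := x) (y := z)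
    [h₁] [h₂, h₃] [h₃, h₂] [] (S.τ h₂ h₃) (by simp [mul_comm]) (by simpa))
  have e₅ := congrArg Additive.ofMul (cellAt_mul S.α₁_cocycle (x := x) (y := x)
    [] [h₁, h₃] [h₃, h₁] [h₂] (S.τ h₁ h₃) (by simp [mul_comm]) (by simp))
  have h' := congrArg Additive.ofMul (S.hexagon₁ h₁ h₂ h₃)
  apply Additive.ofMul.injective
  simp only [bracket_eq_cellAt, cellAt_one_symm _ _ [h₁, h₂] [h₁ * h₂], moveAt, splitAt,
    List.cons_append, List.nil_append, ofMul_mul, ofMul_inv] at *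
  linear_combination (norm := abel) h' - e₁ + e₂ + e₃ - e₄ - e₅

end SemiWeakStructure

namespace TwoEquivalence

variable [StarRing R] {S S' : SemiWeakStructure G H R}

/-- The bracket of `φ` at the position `x`. -/
def phiAt (E : TwoEquivalence S S') (x : H) (g₁ g₂ g₃ : G) : Rˣ :=
  cellAt S'.α₁ x [E.hAut (S.α₀ g₁ g₂ g₃), E.Φ (g₁ * g₂) g₃, E.Φ g₁ g₂]
    [E.Φ g₁ (g₂ * g₃), E.Φ g₂ g₃, S'.α₀ (E.gAut g₁) (E.gAut g₂) (E.gAut g₃)] (E.φ g₁ g₂ g₃)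

theorem cond_τ_at (E : TwoEquivalence S S') (x h₁ h₂ : H) :
    E.barAt S'.α₁ x [h₁, h₂] [h₂, h₁] (S.τ h₁ h₂) =
      moveAt S'.α₁ x (E.hAut h₁) (E.hAut h₂) (S'.τ (E.hAut h₁) (E.hAut h₂)) := by
  have h := E.cond_τ h₁ h₂
  rw [EquivalenceMaps.barBracket] at h
  rw [EquivalenceMaps.barAt,
    cellAt_mul S'.α₁_cocycle (x := x) [] _ _ [] _ (by simp [mul_comm]) (by simp), h,
    moveAt, cellAt_mul S'.α₁_cocycle (x := x) [] _ _ [] _ (by simp [mul_comm]) (by simp)]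
  rfl

theorem barMoveMul_at (E : TwoEquivalence S S') {f h₁ h₂ : H} {t t₁ t₂ : Rˣ}
    (h : E.BarMoveMul S'.toStructureMaps f h₁ h₂ t t₁ t₂) {x y z : H} (hy : y = x * f)
    (hz : z = x * E.hAut h₁) :
    moveAt S'.α₁ x f (E.hAut (h₁ * h₂)) t * E.barAt S'.α₁ x [h₁ * h₂] [h₁, h₂] 1 =
      E.barAt S'.α₁ y [h₁ * h₂] [h₁, h₂] 1 * moveAt S'.α₁ x f (E.hAut h₁) t₁ *
        moveAt S'.α₁ z f (E.hAut h₂) t₂ := by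
  have e₁ := congrArg Additive.ofMul (cellAt_mul S'.α₁_cocycle (x := x) (y := y) [f]
    ([h₁ * h₂].map E.hAut) ([h₁, h₂].map E.hAut) []
    ((E.muWord [h₁ * h₂])⁻¹ * E.uAut 1 * E.muWord [h₁, h₂]) (by simp) (by simpa))
  have e₂ := congrArg Additive.ofMul (cellAt_mul S'.α₁_cocycle (x := x) (y := x)
    [] [f, E.hAut (h₁ * h₂)] [E.hAut (h₁ * h₂), f] [] t (by simp [mul_comm]) (by simp))
  have e₃ := congrArg Additive.ofMul (cellAt_mul S'.α₁_cocycle (x := x) (y := x) []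
    ([h₁ * h₂].map E.hAut) ([h₁, h₂].map E.hAut) [f]
    ((E.muWord [h₁ * h₂])⁻¹ * E.uAut 1 * E.muWord [h₁, h₂]) (by simp) (by simp))
  have e₄ := congrArg Additive.ofMul (cellAt_mul S'.α₁_cocycle (x := x) (y := x)
    [] [f, E.hAut h₁] [E.hAut h₁, f] [E.hAut h₂] t₁ (by simp [mul_comm]) (by simp))
  have e₅ := congrArg Additive.ofMul (cellAt_mul S'.α₁_cocycle (x := x) (y := z)
    [E.hAut h₁] [f, E.hAut h₂] [E.hAut h₂, f] [] t₂ (by simp [mul_comm]) (by simpa))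
  have h' := congrArg Additive.ofMul h
  apply Additive.ofMul.injective
  simp only [EquivalenceMaps.barBracket_eq_barAt,
    EquivalenceMaps.barAt_one_symm _ _ _ [h₁, h₂] [h₁ * h₂], bracket_eq_cellAt] at h'
  simp only [bracket_eq_cellAt, EquivalenceMaps.barAt, moveAt, List.map_cons, List.map_nil,
    List.cons_append, List.nil_append, ofMul_mul, ofMul_inv] at *
  linear_combination (norm := abel) h' - e₁ + e₂ + e₃ - e₄ - e₅

theorem prism_at (E : TwoEquivalence S S') {g₁ g₂ g₃ : G} {h : H} {s₁ s₂ r t₁ t₂ t₃ : Rˣ}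
    (hp : E.Prism S.toStructureMaps S'.toStructureMaps g₁ g₂ g₃ h s₁ s₂ r t₁ t₂ t₃)
    {x x₁ x₂ x₃ y₁ y₂ : H} (hx₁ : x₁ = x * E.hAut (S.α₀ g₁ g₂ g₃) * E.Φ (g₁ * g₂) g₃)
    (hx₂ : x₂ = x * E.hAut (S.α₀ g₁ g₂ g₃)) (hx₃ : x₃ = x * E.hAut h)
    (hy₁ : y₁ = x * E.Φ g₁ (g₂ * g₃) * E.Φ g₂ g₃) (hy₂ : y₂ = x * E.Φ g₁ (g₂ * g₃)) :
    moveAt S'.α₁ x₁ (E.Φ g₁ g₂) (E.hAut h) s₁ *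
        moveAt S'.α₁ x₂ (E.Φ (g₁ * g₂) g₃) (E.hAut h) s₂ *
        E.barAt S'.α₁ x [S.α₀ g₁ g₂ g₃, h] [h, S.α₀ g₁ g₂ g₃] r * E.phiAt x₃ g₁ g₂ g₃ =
      E.phiAt x g₁ g₂ g₃ *
        moveAt S'.α₁ y₁ (S'.α₀ (E.gAut g₁) (E.gAut g₂) (E.gAut g₃)) (E.hAut h) t₁ *
        moveAt S'.α₁ y₂ (E.Φ g₂ g₃) (E.hAut h) t₂ *
        moveAt S'.α₁ x (E.Φ g₁ (g₂ * g₃)) (E.hAut h) t₃ := by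
  have hφ := E.cond_α₀ g₁ g₂ g₃
  unfold EquivalenceMaps.Prism at hp
  simp only [EquivalenceMaps.barBracket, phiAt, EquivalenceMaps.barAt] at hp ⊢
  generalize S.α₀ g₁ g₂ g₃ = a, S'.α₀ (E.gAut g₁) (E.gAut g₂) (E.gAut g₃) = a' at *
  generalize E.Φ (g₁ * g₂) g₃ = f₂, E.Φ g₁ g₂ = f₁, E.Φ g₁ (g₂ * g₃) = k₁, E.Φ g₂ g₃ = k₂ at *
  generalize E.φ g₁ g₂ g₃ = w at *
  have c := S'.α₁_cocycle
  have comm₁ : ∀ k l : H, [k, l].prod = [l, k].prod := fun k l => by simp [mul_comm]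
  have e₁ := congrArg Additive.ofMul
    (cellAt_mul c (x := x) (y := x₁) [E.hAut a, f₂] _ _ [] s₁ (comm₁ f₁ (E.hAut h))
      (by simpa [mul_assoc] using hx₁))
  have e₂ := congrArg Additive.ofMul
    (cellAt_mul c (x := x) (y := x₂) [E.hAut a] _ _ [f₁] s₂ (comm₁ f₂ (E.hAut h)) (by simpa))
  have e₃ := congrArg Additive.ofMul (cellAt_mul c (x := x) (y := x) []
    ([a, h].map E.hAut) ([h, a].map E.hAut) [f₂, f₁]
    ((E.muWord [a, h])⁻¹ * E.uAut r * E.muWord [h, a]) (by simp [mul_comm]) (by simp))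
  have e₄ := congrArg Additive.ofMul (cellAt_mul c (x := x) (y := x₃) [E.hAut h]
    [E.hAut a, f₂, f₁] [k₁, k₂, a'] [] w (by simpa [mul_assoc] using hφ) (by simpa))
  have e₅ := congrArg Additive.ofMul (cellAt_mul c (x := x) (y := x) []
    [E.hAut a, f₂, f₁] [k₁, k₂, a'] [E.hAut h] w (by simpa [mul_assoc] using hφ) (by simp))
  have e₆ := congrArg Additive.ofMul
    (cellAt_mul c (x := x) (y := y₁) [k₁, k₂] _ _ [] t₁ (comm₁ a' (E.hAut h))
      (by simpa [mul_assoc] using hy₁))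
  have e₇ := congrArg Additive.ofMul
    (cellAt_mul c (x := x) (y := y₂) [k₁] _ _ [a'] t₂ (comm₁ k₂ (E.hAut h)) (by simpa))
  have e₈ := congrArg Additive.ofMul
    (cellAt_mul c (x := x) (y := x) [] _ _ [k₂, a'] t₃ (comm₁ k₁ (E.hAut h)) (by simp))
  have h' := congrArg Additive.ofMul hp
  apply Additive.ofMul.injective
  simp only [moveAt, List.map_cons, List.map_nil, List.cons_append, List.nil_append, ofMul_mul,
    ofMul_inv] at *
  linear_combination (norm := abel) h' + e₁ + e₂ + e₃ + e₄ - e₅ - e₆ - e₇ - e₈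

theorem pentagon_at (E : TwoEquivalence S S') (g₁ g₂ g₃ g₄ : G)
    {x p₁ p₂ p₃ p₄ p₅ p₆ q₁ q₂ q₃ q₄ : H}
    (hp₁ : p₁ = x * E.hAut (S.α₀ g₂ g₃ g₄) * E.hAut (S.α₀ g₁ (g₂ * g₃) g₄))
    (hp₂ : p₂ = p₁ * E.Φ (g₁ * (g₂ * g₃)) g₄)
    (hp₃ : p₃ = x * E.hAut (S.α₀ g₂ g₃ g₄))
    (hp₄ : p₄ = p₃ * E.Φ g₁ (g₂ * (g₃ * g₄)) * E.Φ (g₂ * g₃) g₄)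
    (hp₅ : p₅ = x * E.Φ g₁ (g₂ * (g₃ * g₄)))
    (hp₆ : p₆ = p₅ * E.Φ g₂ (g₃ * g₄) * E.Φ g₃ g₄)
    (hq₁ : q₁ = x * E.hAut (S.α₀ g₁ g₂ (g₃ * g₄)))
    (hq₂ : q₂ = q₁ * E.Φ (g₁ * g₂) (g₃ * g₄) * E.Φ g₃ g₄)
    (hq₃ : q₃ = q₁ * E.Φ (g₁ * g₂) (g₃ * g₄))
    (hq₄ : q₄ = p₅ * E.Φ g₂ (g₃ * g₄)) :
    (moveAt S'.α₁ p₁ (E.Φ (g₁ * (g₂ * g₃)) g₄) (E.hAut (S.α₀ g₁ g₂ g₃))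
          (E.ψ (S.α₀ g₁ g₂ g₃) g₄))⁻¹ *
        E.phiAt p₂ g₁ g₂ g₃ * E.phiAt p₃ g₁ (g₂ * g₃) g₄ *
        moveAt S'.α₁ p₄ (S'.α₀ (E.gAut g₁) (E.gAut (g₂ * g₃)) (E.gAut g₄)) (E.Φ g₂ g₃)
          (S'.ι₂ (E.gAut g₁) (E.Φ g₂ g₃) (E.gAut g₄)) *
        (moveAt S'.α₁ x (E.Φ g₁ (g₂ * (g₃ * g₄))) (E.hAut (S.α₀ g₂ g₃ g₄))
          (E.χ g₁ (S.α₀ g₂ g₃ g₄)))⁻¹ *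
        E.phiAt p₅ g₂ g₃ g₄ *
        S'.piAt p₆ (E.gAut g₁) (E.gAut g₂) (E.gAut g₃) (E.gAut g₄) =
      E.barAt S'.α₁ x [S.α₀ g₂ g₃ g₄, S.α₀ g₁ (g₂ * g₃) g₄, S.α₀ g₁ g₂ g₃]
          [S.α₀ g₁ g₂ (g₃ * g₄), S.α₀ (g₁ * g₂) g₃ g₄] (S.π g₁ g₂ g₃ g₄) *
        E.phiAt q₁ (g₁ * g₂) g₃ g₄ *
        moveAt S'.α₁ q₂ (S'.α₀ (E.gAut (g₁ * g₂)) (E.gAut g₃) (E.gAut g₄)) (E.Φ g₁ g₂)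
          (S'.ι₁ (E.Φ g₁ g₂) (E.gAut g₃) (E.gAut g₄)) *
        (moveAt S'.α₁ q₃ (E.Φ g₁ g₂) (E.Φ g₃ g₄) (S'.τ (E.Φ g₁ g₂) (E.Φ g₃ g₄)))⁻¹ *
        E.phiAt x g₁ g₂ (g₃ * g₄) *
        moveAt S'.α₁ q₄ (S'.α₀ (E.gAut g₁) (E.gAut g₂) (E.gAut (g₃ * g₄))) (E.Φ g₃ g₄)
          (S'.ι₃ (E.gAut g₁) (E.gAut g₂) (E.Φ g₃ g₄)) := by
  subst hp₁ hp₂ hp₄ hp₃ hp₆ hq₄ hp₅ hq₂ hq₃ hq₁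
  have hp := E.cond_π g₁ g₂ g₃ g₄
  have hz := E.cond_α₀ g₁ g₂ g₃
  have hy := E.cond_α₀ g₁ (g₂ * g₃) g₄
  have hx := E.cond_α₀ g₂ g₃ g₄
  have hq := E.cond_α₀ (g₁ * g₂) g₃ g₄
  have hp' := E.cond_α₀ g₁ g₂ (g₃ * g₄)
  have hπ := congrArg E.hAut (S.α₀_pentagon g₁ g₂ g₃ g₄)
  have hπ' := S'.α₀_pentagon (E.gAut g₁) (E.gAut g₂) (E.gAut g₃) (E.gAut g₄)
  unfold EquivalenceMaps.PentagonCondition at hp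
  simp only [EquivalenceMaps.barBracket, phiAt, SemiWeakStructure.piAt, EquivalenceMaps.barAt,
    map_mul, mul_assoc g₁ g₂, mul_assoc g₂ g₃ g₄] at *
  generalize S.α₀ g₂ g₃ g₄ = X, S.α₀ g₁ (g₂ * g₃) g₄ = Y, S.α₀ g₁ g₂ g₃ = Z,
    S.α₀ g₁ g₂ (g₃ * g₄) = P, S.α₀ (g₁ * g₂) g₃ g₄ = Q at *
  generalize E.gAut g₁ = k₁, E.gAut g₂ = k₂, E.gAut g₃ = k₃, E.gAut g₄ = k₄ at *
  generalize S'.α₀ k₂ k₃ k₄ = X', S'.α₀ k₁ (k₂ * k₃) k₄ = Y', S'.α₀ k₁ k₂ k₃ = Z',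
    S'.α₀ k₁ k₂ (k₃ * k₄) = P', S'.α₀ (k₁ * k₂) k₃ k₄ = Q' at *
  generalize E.Φ g₁ g₂ = f₁₂, E.Φ g₂ g₃ = f₂₃, E.Φ g₃ g₄ = f₃₄, E.Φ (g₁ * g₂) g₃ = l₃,
    E.Φ g₁ (g₂ * g₃) = l₁, E.Φ (g₂ * g₃) g₄ = r₄, E.Φ g₂ (g₃ * g₄) = r₂,
    E.Φ (g₁ * g₂) (g₃ * g₄) = m, E.Φ (g₁ * (g₂ * g₃)) g₄ = n₄,
    E.Φ g₁ (g₂ * (g₃ * g₄)) = n₁ at *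
  generalize E.φ g₁ g₂ g₃ = w₁, E.φ g₁ (g₂ * g₃) g₄ = w₂, E.φ g₂ g₃ g₄ = w₃,
    E.φ (g₁ * g₂) g₃ g₄ = w₄, E.φ g₁ g₂ (g₃ * g₄) = w₅ at *
  have c := S'.α₁_cocycle
  have comm : ∀ k l : H, [k, l].prod = [l, k].prod := fun k l => by simp [mul_comm]
  have e₁ := congrArg Additive.ofMul (cellAt_mul c (x := x) (y := x * E.hAut X * E.hAut Y)
    [E.hAut X, E.hAut Y] _ _ [l₃, f₁₂] (E.ψ Z g₄)⁻¹ (comm (E.hAut Z) n₄) (by simp [mul_assoc]))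
  have e₂ := congrArg Additive.ofMul (cellAt_mul c (x := x) (y := x * E.hAut X * E.hAut Y * n₄)
    [E.hAut X, E.hAut Y, n₄] [E.hAut Z, l₃, f₁₂] [l₁, f₂₃, Z'] [] w₁
    (by simpa [mul_assoc] using hz) (by simp [mul_assoc]))
  have e₃ := congrArg Additive.ofMul (cellAt_mul c (x := x) (y := x * E.hAut X)
    [E.hAut X] [E.hAut Y, n₄, l₁] [n₁, r₄, Y'] [f₂₃, Z'] w₂
    (by simpa [mul_assoc] using hy) (by simp))
  have e₄ := congrArg Additive.ofMul (cellAt_mul c (x := x) (y := x * E.hAut X * n₁ * r₄)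
    [E.hAut X, n₁, r₄] _ _ [Z'] (S'.ι₂ k₁ f₂₃ k₄) (comm Y' f₂₃) (by simp [mul_assoc]))
  have e₅ := congrArg Additive.ofMul (cellAt_mul c (x := x) (y := x)
    [] _ _ [r₄, f₂₃, Y', Z'] (E.χ g₁ X)⁻¹ (comm (E.hAut X) n₁) (by simp))
  have e₆ := congrArg Additive.ofMul (cellAt_mul c (x := x) (y := x * n₁)
    [n₁] [E.hAut X, r₄, f₂₃] [r₂, f₃₄, X'] [Y', Z'] w₃
    (by simpa [mul_assoc] using hx) (by simp))
  have e₇ := congrArg Additive.ofMul (cellAt_mul c (x := x) (y := x * n₁ * r₂ * f₃₄)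
    [n₁, r₂, f₃₄] [X', Y', Z'] [P', Q'] [] (S'.π k₁ k₂ k₃ k₄)
    (by simpa [mul_assoc] using hπ') (by simp [mul_assoc]))
  have d₁ := congrArg Additive.ofMul (cellAt_mul c (x := x) (y := x)
    [] ([X, Y, Z].map E.hAut) ([P, Q].map E.hAut) [n₄, l₃, f₁₂]
    ((E.muWord [X, Y, Z])⁻¹ * E.uAut (S.π g₁ g₂ g₃ g₄) * E.muWord [P, Q])
    (by simpa [mul_assoc] using hπ) (by simp))
  have d₂ := congrArg Additive.ofMul (cellAt_mul c (x := x) (y := x * E.hAut P)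
    [E.hAut P] [E.hAut Q, n₄, l₃] [m, f₃₄, Q'] [f₁₂] w₄
    (by simpa [mul_assoc] using hq) (by simp))
  have d₃ := congrArg Additive.ofMul (cellAt_mul c (x := x) (y := x * E.hAut P * m * f₃₄)
    [E.hAut P, m, f₃₄] _ _ [] (S'.ι₁ f₁₂ k₃ k₄) (comm Q' f₁₂) (by simp [mul_assoc]))
  have d₄ := congrArg Additive.ofMul (cellAt_mul c (x := x) (y := x * E.hAut P * m)
    [E.hAut P, m] _ _ [Q'] (S'.τ f₁₂ f₃₄)⁻¹ (comm f₃₄ f₁₂) (by simp [mul_assoc]))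
  have d₅ := congrArg Additive.ofMul (cellAt_mul c (x := x) (y := x)
    [] [E.hAut P, m, f₁₂] [n₁, r₂, P'] [f₃₄, Q'] w₅
    (by simpa [mul_assoc] using hp') (by simp))
  have d₆ := congrArg Additive.ofMul (cellAt_mul c (x := x) (y := x * n₁ * r₂)
    [n₁, r₂] _ _ [Q'] (S'.ι₃ k₁ k₂ f₃₄) (comm P' f₃₄) (by simp [mul_assoc]))
  have h' := congrArg Additive.ofMul hp
  apply Additive.ofMul.injective
  simp only [moveAt, ← cellAt_inv, List.map_cons, List.map_nil, List.cons_append, List.nil_append,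
    ofMul_mul, ofMul_inv] at e₁ e₂ e₃ e₄ e₅ e₆ e₇ d₁ d₂ d₃ d₄ d₅ d₆ h' ⊢
  linear_combination (norm := abel) h' + e₁ + e₂ + e₃ + e₄ + e₅ + e₆ + e₇ - d₁ - d₂ - d₃ - d₄
    - d₅ - d₆

/-- The bar of the identity between the two words of a tetrahedron, in terms of identities between
a letter and a word of two letters. -/
theorem barAt_three_two (E : TwoEquivalence S S') (x h₁ h₂ a h₃ h₄ : H)
    (h : h₁ * h₂ * a = h₃ * h₄) :
    E.barAt S'.α₁ x [h₁, h₂, a] [h₃, h₄] 1 =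
      (E.barAt S'.α₁ x [h₁ * h₂] [h₁, h₂] 1)⁻¹ *
        (E.barAt S'.α₁ x [h₁ * h₂ * a] [h₁ * h₂, a] 1)⁻¹ *
        E.barAt S'.α₁ x [h₃ * h₄] [h₃, h₄] 1 := by
  rw [← EquivalenceMaps.barAt_one_symm, ← EquivalenceMaps.barAt_one_symm, h,
    ← EquivalenceMaps.barAt_append _ _ x [h₁, h₂] [h₁ * h₂] [a] 1 (by simp)]
  simp only [List.cons_append, List.nil_append, EquivalenceMaps.barAt_trans, mul_one]

/-- Moves past `f` that are multiplicative are natural with respect to the identity between the two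
words of a tetrahedron. -/
theorem move_word_at (E : TwoEquivalence S S') {f : H} {t : H → Rˣ}
    (ht : ∀ h₁ h₂, E.BarMoveMul S'.toStructureMaps f h₁ h₂ (t (h₁ * h₂)) (t h₁) (t h₂))
    {h₁ h₂ a h₃ h₄ : H} (h : h₁ * h₂ * a = h₃ * h₄) {x y z₁ z₂ z₃ : H} (hy : y = x * f)
    (hz₁ : z₁ = x * E.hAut h₁) (hz₂ : z₂ = x * E.hAut h₁ * E.hAut h₂)
    (hz₃ : z₃ = x * E.hAut h₃) :
    E.barAt S'.α₁ y [h₁, h₂, a] [h₃, h₄] 1 * moveAt S'.α₁ x f (E.hAut h₃) (t h₃) *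
        moveAt S'.α₁ z₃ f (E.hAut h₄) (t h₄) =
      moveAt S'.α₁ x f (E.hAut h₁) (t h₁) * moveAt S'.α₁ z₁ f (E.hAut h₂) (t h₂) *
        moveAt S'.α₁ z₂ f (E.hAut a) (t a) * E.barAt S'.α₁ x [h₁, h₂, a] [h₃, h₄] 1 := by
  have e₁ := congrArg Additive.ofMul (E.barMoveMul_at (ht h₁ h₂) hy hz₁)
  have e₂ := congrArg Additive.ofMul (E.barMoveMul_at (ht (h₁ * h₂) a) (z := z₂) hy
    (by rw [hz₂, map_mul, mul_assoc]))
  have e₃ := congrArg Additive.ofMul (E.barMoveMul_at (ht h₃ h₄) hy hz₃)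
  apply Additive.ofMul.injective
  simp only [E.barAt_three_two _ _ _ _ _ _ h, ofMul_mul, ofMul_inv, h] at e₁ e₂ e₃ ⊢
  linear_combination (norm := abel) e₁ + e₂ - e₃

/-! ### The defect of a tetrahedron -/

/-- The new label of a triangle with the old label `h`, whose two short edges have the labels `g₂`
and `g₃`. -/
def newLabel (E : TwoEquivalence S S') (g₂ g₃ : G) (h : H) : H :=
  E.hAut h * E.Φ g₂ g₃

theorem newLabel_flat (E : TwoEquivalence S S') {g₁ g₂ g₃ : G} {k l m n : H}
    (h : k * l * S.α₀ g₁ g₂ g₃ = m * n) :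
    E.newLabel g₁ (g₂ * g₃) k * E.newLabel g₂ g₃ l *
        S'.α₀ (E.gAut g₁) (E.gAut g₂) (E.gAut g₃) =
      E.newLabel (g₁ * g₂) g₃ m * E.newLabel g₁ g₂ n := by
  have e := congrArg Additive.ofMul (E.cond_α₀ g₁ g₂ g₃)
  have e' := congrArg (fun w => Additive.ofMul (E.hAut w)) h
  apply Additive.ofMul.injective
  simp only [newLabel, map_mul, ofMul_mul] at e e' ⊢
  linear_combination (norm := abel) e' - e

/-- The defect of a tetrahedron `(ijkl)` with `g₁, g₂, g₃ = g_{kl}, g_{jk}, g_{ij}` and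
`k, l, m, n = h_{ikl}, h_{ijk}, h_{ijl}, h_{jkl}`. The identity between the two words of new labels
agrees, up to this scalar, with the composite that splits the new labels into barred labels and
values of `Φ`, sorts them by `χ`, and applies `φ⁻¹`, the bar of the identity between the two words
of old labels, `ψ⁻¹`, and the reverse of the splitting. -/
def defect (E : TwoEquivalence S S') (g₁ g₂ g₃ : G) (k l m n : H) : Rˣ :=
  let br := bracket S'.α₁
  let a := S.α₀ g₁ g₂ g₃
  let a' := S'.α₀ (E.gAut g₁) (E.gAut g₂) (E.gAut g₃)
  let fk := E.Φ g₁ (g₂ * g₃)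
  let fl := E.Φ g₂ g₃
  let fm := E.Φ (g₁ * g₂) g₃
  let fn := E.Φ g₁ g₂
  br [] [E.newLabel g₁ (g₂ * g₃) k, E.newLabel g₂ g₃ l, a']
      [E.newLabel (g₁ * g₂) g₃ m, E.newLabel g₁ g₂ n] 1 *
    (br [] [E.newLabel g₁ (g₂ * g₃) k] [E.hAut k, fk] 1 *
      br [E.hAut k, fk] [E.newLabel g₂ g₃ l] [E.hAut l, fl] 1 *
      br [E.hAut k] [fk, E.hAut l] [E.hAut l, fk] (E.χ g₁ l) *
      br [E.hAut k, E.hAut l] [fk, fl, a'] [E.hAut a, fm, fn] (E.φ g₁ g₂ g₃)⁻¹ *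
      E.barBracket S'.α₁ [] [k, l, a] [m, n] 1 *
      br [E.hAut m] [E.hAut n, fm] [fm, E.hAut n] (E.ψ n g₃)⁻¹ *
      br [] [E.hAut m, fm] [E.newLabel (g₁ * g₂) g₃ m] 1 *
      br [E.newLabel (g₁ * g₂) g₃ m] [E.hAut n, fn] [E.newLabel g₁ g₂ n] 1)⁻¹

theorem tetrahedron_at (E : TwoEquivalence S S') {g₁ g₂ g₃ : G} {k l m n : H}
    (h : k * l * S.α₀ g₁ g₂ g₃ = m * n) {x x₁ x₂ x₃ y₁ y₂ : H}
    (hx₁ : x₁ = x * E.newLabel g₁ (g₂ * g₃) k) (hx₂ : x₂ = x * E.hAut k)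
    (hx₃ : x₃ = x * E.hAut k * E.hAut l) (hy₁ : y₁ = x * E.hAut m)
    (hy₂ : y₂ = x * E.newLabel (g₁ * g₂) g₃ m) :
    cellAt S'.α₁ x [E.newLabel g₁ (g₂ * g₃) k, E.newLabel g₂ g₃ l,
        S'.α₀ (E.gAut g₁) (E.gAut g₂) (E.gAut g₃)]
        [E.newLabel (g₁ * g₂) g₃ m, E.newLabel g₁ g₂ n] 1 =
      splitAt S'.α₁ x (E.hAut k) (E.Φ g₁ (g₂ * g₃)) * splitAt S'.α₁ x₁ (E.hAut l) (E.Φ g₂ g₃) *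
        moveAt S'.α₁ x₂ (E.Φ g₁ (g₂ * g₃)) (E.hAut l) (E.χ g₁ l) *
        (E.phiAt x₃ g₁ g₂ g₃)⁻¹ *
        E.barAt S'.α₁ x [k, l, S.α₀ g₁ g₂ g₃] [m, n] 1 *
        (moveAt S'.α₁ y₁ (E.Φ (g₁ * g₂) g₃) (E.hAut n) (E.ψ n g₃))⁻¹ *
        (splitAt S'.α₁ x (E.hAut m) (E.Φ (g₁ * g₂) g₃))⁻¹ *
        (splitAt S'.α₁ y₂ (E.hAut n) (E.Φ g₁ g₂))⁻¹ *
        E.defect g₁ g₂ g₃ k l m n := by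
  have hφ := E.cond_α₀ g₁ g₂ g₃
  have hflat' := E.newLabel_flat h
  have hflat := congrArg E.hAut h
  simp only [newLabel, map_mul] at hflat' hflat hx₁ hy₂
  simp only [defect, phiAt, splitAt, moveAt, newLabel, EquivalenceMaps.barBracket,
    EquivalenceMaps.barAt, ← cellAt_inv, inv_one]
  generalize S.α₀ g₁ g₂ g₃ = a, S'.α₀ (E.gAut g₁) (E.gAut g₂) (E.gAut g₃) = a' at *
  generalize E.Φ (g₁ * g₂) g₃ = fm, E.Φ g₁ g₂ = fn, E.Φ g₁ (g₂ * g₃) = fk, E.Φ g₂ g₃ = fl at *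
  have c := S'.α₁_cocycle
  have comm : ∀ k l : H, [k, l].prod = [l, k].prod := fun k l => by simp [mul_comm]
  have e₀ := congrArg Additive.ofMul (cellAt_mul c (x := x) (y := x) []
    [E.hAut k * fk, E.hAut l * fl, a'] [E.hAut m * fm, E.hAut n * fn] [] 1
    (by simpa [mul_assoc] using hflat') (by simp))
  have e₁ := congrArg Additive.ofMul (cellAt_mul c (x := x) (y := x) []
    [E.hAut k * fk] [E.hAut k, fk] [E.hAut l * fl, a'] 1 (by simp) (by simp))
  have e₂ := congrArg Additive.ofMul (cellAt_mul c (x := x) (y := x₁) [E.hAut k, fk]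
    [E.hAut l * fl] [E.hAut l, fl] [a'] 1 (by simp) (by simpa using hx₁))
  have e₃ := congrArg Additive.ofMul (cellAt_mul c (x := x) (y := x₂) [E.hAut k]
    [fk, E.hAut l] [E.hAut l, fk] [fl, a'] (E.χ g₁ l) (comm _ _) (by simpa using hx₂))
  have e₄ := congrArg Additive.ofMul (cellAt_mul c (x := x) (y := x₃) [E.hAut k, E.hAut l]
    [fk, fl, a'] [E.hAut a, fm, fn] [] (E.φ g₁ g₂ g₃)⁻¹ (by simpa [mul_assoc] using hφ.symm)
    (by simpa [mul_assoc] using hx₃))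
  have e₅ := congrArg Additive.ofMul (cellAt_mul c (x := x) (y := x) []
    ([k, l, a].map E.hAut) ([m, n].map E.hAut) [fm, fn]
    ((E.muWord [k, l, a])⁻¹ * E.uAut 1 * E.muWord [m, n])
    (by simpa [mul_assoc] using hflat) (by simp))
  have e₆ := congrArg Additive.ofMul (cellAt_mul c (x := x) (y := y₁) [E.hAut m]
    [E.hAut n, fm] [fm, E.hAut n] [fn] (E.ψ n g₃)⁻¹ (comm _ _) (by simpa using hy₁))
  have e₇ := congrArg Additive.ofMul (cellAt_mul c (x := x) (y := x) []
    [E.hAut m, fm] [E.hAut m * fm] [E.hAut n, fn] 1 (by simp) (by simp))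
  have e₈ := congrArg Additive.ofMul (cellAt_mul c (x := x) (y := y₂) [E.hAut m * fm]
    [E.hAut n, fn] [E.hAut n * fn] [] 1 (by simp) (by simpa using hy₂))
  apply Additive.ofMul.injective
  simp only [List.map_cons, List.map_nil, List.cons_append, List.nil_append,
    ofMul_mul, ofMul_inv] at e₀ e₁ e₂ e₃ e₄ e₅ e₆ e₇ e₈ ⊢
  linear_combination (norm := abel) e₀ - e₁ - e₂ - e₃ - e₄ - e₅ - e₆ - e₇ - e₈

end TwoEquivalence

end Conditions

/-! ### The scalar of a 4-simplex -/

section Simplex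

variable {G H R : Type*} [Group G] [CommGroup H] [CommRing R]

/-- The scalar of a 4-simplex `(01234)` as a function of the labels `a, b, c, d` of the edges
`(34), (23), (12), (01)` and of the labels of the ten triangles. -/
def simplexScalar (S : StructureMaps G H R) (a b c d : G)
    (h012 h013 h014 h023 h024 h034 h123 h124 h134 h234 : H) : Rˣ :=
  let br := bracket S.α₁
  br [h034, h023] [h012, S.α₀ a b (c * d)] [S.α₀ a b (c * d), h012] (S.ι₃ a b h012)⁻¹ *
    br [] [h034, h023, S.α₀ a b (c * d)] [h024, h234] 1 *
    br [h024] [h234, h012] [h012, h234] (S.τ h234 h012) *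
    br [h024, h012] [h234, S.α₀ (a * b) c d] [S.α₀ (a * b) c d, h234] (S.ι₁ h234 c d)⁻¹ *
    br [] [h024, h012, S.α₀ (a * b) c d] [h014, h124] 1 *
    br [h014] [h124, h234] [h134, h123, S.α₀ a b c] 1 *
    br [] [h014, h134] [h034, h013, S.α₀ a (b * c) d] 1 *
    br [h034, h013] [S.α₀ a (b * c) d, h123] [h123, S.α₀ a (b * c) d] (S.ι₂ a h123 d) *
    br [h034] [h013, h123] [h023, h012, S.α₀ b c d] 1 *
    br [h034, h023, h012] [S.α₀ b c d, S.α₀ a (b * c) d, S.α₀ a b c]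
      [S.α₀ a b (c * d), S.α₀ (a * b) c d] (S.π a b c d)

theorem SemiWeakStructure.simplexScalar_eq (S : SemiWeakStructure G H R) (a b c d : G)
    (h012 h013 h014 h023 h024 h034 h123 h124 h134 h234 : H) :
    simplexScalar S.toStructureMaps a b c d h012 h013 h014 h023 h024 h034 h123 h124 h134 h234 =
      (moveAt S.α₁ (h034 * h023) (S.α₀ a b (c * d)) h012 (S.ι₃ a b h012))⁻¹ *
        cellAt S.α₁ 1 [h034, h023, S.α₀ a b (c * d)] [h024, h234] 1 *
        moveAt S.α₁ h024 h234 h012 (S.τ h234 h012) *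
        (moveAt S.α₁ (h024 * h012) (S.α₀ (a * b) c d) h234 (S.ι₁ h234 c d))⁻¹ *
        cellAt S.α₁ 1 [h024, h012, S.α₀ (a * b) c d] [h014, h124] 1 *
        (cellAt S.α₁ h014 [h134, h123, S.α₀ a b c] [h124, h234] 1)⁻¹ *
        (cellAt S.α₁ 1 [h034, h013, S.α₀ a (b * c) d] [h014, h134] 1)⁻¹ *
        moveAt S.α₁ (h034 * h013) (S.α₀ a (b * c) d) h123 (S.ι₂ a h123 d) *
        (cellAt S.α₁ h034 [h023, h012, S.α₀ b c d] [h013, h123] 1)⁻¹ *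
        S.piAt (h034 * h023 * h012) a b c d := by
  simp only [simplexScalar, bracket_eq_cellAt, moveAt, SemiWeakStructure.piAt, ← cellAt_inv,
    inv_one, List.prod_cons, List.prod_nil, mul_one, mul_assoc]

/-- In a braided categorical group, the letters `h` and `k` can be moved past `f` and exchanged in
either order, whatever the scalars of the moves: these cancel, and what remains is that the
1-associator has trivial antisymmetrization, which follows from the second hexagon. -/
theorem SemiWeakStructure.moveAt_exchange (S : SemiWeakStructure G H R) (f h k : H) (r s t : Rˣ)
    {x y z w : H} (hy : y = x * f) (hz : z = x * h) (hw : w = x * k) :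
    moveAt S.α₁ x f h r * moveAt S.α₁ z f k s * moveAt S.α₁ x h k t =
      moveAt S.α₁ y h k t * moveAt S.α₁ x f k s * moveAt S.α₁ w f h r := by
  have move_eq : ∀ (x a b : H) (t : Rˣ), moveAt S.α₁ x a b t = moveAt S.α₁ x a b 1 * t :=
    fun x a b t => by simp only [moveAt, cellAt]; rw [mul_one, mul_right_comm]
  have swap_eq : ∀ x : H, moveAt S.α₁ x h k 1 =
      (splitAt S.α₁ x h k)⁻¹ * splitAt S.α₁ x k h := fun x => by
    rw [splitAt, splitAt, ← cellAt_inv, mul_comm k h, cellAt_trans, inv_one, mul_one, moveAt]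
  have e₁ := congrArg Additive.ofMul (S.moveAt_mul_right (S.hexagon₂ f h k) hy hz)
  have e₂ := congrArg Additive.ofMul (S.moveAt_mul_right (S.hexagon₂ f k h) hy hw)
  rw [mul_comm k h] at e₂
  apply Additive.ofMul.injective
  rw [move_eq x f h, move_eq z f k, move_eq x h k, move_eq y h k, move_eq x f k, move_eq w f h,
    swap_eq, swap_eq]
  rw [move_eq _ f h (S.τ f h), move_eq _ f k (S.τ f k)] at e₁ e₂
  simp only [ofMul_mul, ofMul_inv] at e₁ e₂ ⊢
  linear_combination (norm := abel) e₂ - e₁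

namespace TwoEquivalence

variable [StarRing R] {S S' : SemiWeakStructure G H R}

theorem uAut_simplexScalar (E : TwoEquivalence S S') (a b c d : G)
    (h012 h013 h014 h023 h024 h034 h123 h124 h134 h234 : H)
    (f0123 : h023 * h012 * S.α₀ b c d = h013 * h123)
    (f0124 : h024 * h012 * S.α₀ (a * b) c d = h014 * h124)
    (f0134 : h034 * h013 * S.α₀ a (b * c) d = h014 * h134)
    (f0234 : h034 * h023 * S.α₀ a b (c * d) = h024 * h234)
    (f1234 : h134 * h123 * S.α₀ a b c = h124 * h234) :
    E.uAut (simplexScalar S.toStructureMaps a b c d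
        h012 h013 h014 h023 h024 h034 h123 h124 h134 h234) =
      (E.barAt S'.α₁ (E.hAut h034 * E.hAut h023) [S.α₀ a b (c * d), h012]
          [h012, S.α₀ a b (c * d)] (S.ι₃ a b h012))⁻¹ *
        E.barAt S'.α₁ 1 [h034, h023, S.α₀ a b (c * d)] [h024, h234] 1 *
        E.barAt S'.α₁ (E.hAut h024) [h234, h012] [h012, h234] (S.τ h234 h012) *
        (E.barAt S'.α₁ (E.hAut h024 * E.hAut h012) [S.α₀ (a * b) c d, h234]
          [h234, S.α₀ (a * b) c d] (S.ι₁ h234 c d))⁻¹ *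
        E.barAt S'.α₁ 1 [h024, h012, S.α₀ (a * b) c d] [h014, h124] 1 *
        (E.barAt S'.α₁ (E.hAut h014) [h134, h123, S.α₀ a b c] [h124, h234] 1)⁻¹ *
        (E.barAt S'.α₁ 1 [h034, h013, S.α₀ a (b * c) d] [h014, h134] 1)⁻¹ *
        E.barAt S'.α₁ (E.hAut h034 * E.hAut h013) [S.α₀ a (b * c) d, h123]
          [h123, S.α₀ a (b * c) d] (S.ι₂ a h123 d) *
        (E.barAt S'.α₁ (E.hAut h034) [h023, h012, S.α₀ b c d] [h013, h123] 1)⁻¹ *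
        E.barAt S'.α₁ (E.hAut h034 * E.hAut h023 * E.hAut h012)
          [S.α₀ b c d, S.α₀ a (b * c) d, S.α₀ a b c] [S.α₀ a b (c * d), S.α₀ (a * b) c d]
          (S.π a b c d) := by
  have hπ := S.α₀_pentagon a b c d
  simp only [simplexScalar, map_mul]
  generalize S.α₀ a b (c * d) = p, S.α₀ (a * b) c d = q, S.α₀ a b c = z,
    S.α₀ a (b * c) d = y, S.α₀ b c d = x at *
  have comm : ∀ k l : H, [k, l].prod = [l, k].prod := fun k l => by simp [mul_comm]
  have m := E.cond_α₁
  rw [E.uAut_bracket m (α' := S'.α₁) (y := E.hAut h034 * E.hAut h023)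
      [h034, h023] [h012, p] [p, h012] [q] _ (comm _ _) (by simp),
    E.uAut_bracket m (α' := S'.α₁) (y := 1)
      [] [h034, h023, p] [h024, h234] [h012, q] _ (by simpa [mul_assoc] using f0234) (by simp),
    E.uAut_bracket m (α' := S'.α₁) (y := E.hAut h024)
      [h024] [h234, h012] [h012, h234] [q] _ (comm _ _) (by simp),
    E.uAut_bracket m (α' := S'.α₁) (y := E.hAut h024 * E.hAut h012)
      [h024, h012] [h234, q] [q, h234] [] _ (comm _ _) (by simp),
    E.uAut_bracket m (α' := S'.α₁) (y := 1)
      [] [h024, h012, q] [h014, h124] [h234] _ (by simpa [mul_assoc] using f0124) (by simp),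
    E.uAut_bracket m (α' := S'.α₁) (y := E.hAut h014)
      [h014] [h124, h234] [h134, h123, z] [] _ (by simpa [mul_assoc] using f1234.symm) (by simp),
    E.uAut_bracket m (α' := S'.α₁) (y := 1)
      [] [h014, h134] [h034, h013, y] [h123, z] _ (by simpa [mul_assoc] using f0134.symm)
      (by simp),
    E.uAut_bracket m (α' := S'.α₁) (y := E.hAut h034 * E.hAut h013)
      [h034, h013] [y, h123] [h123, y] [z] _ (comm _ _) (by simp),
    E.uAut_bracket m (α' := S'.α₁) (y := E.hAut h034)
      [h034] [h013, h123] [h023, h012, x] [y, z] _ (by simpa [mul_assoc] using f0123.symm)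
      (by simp),
    E.uAut_bracket m (α' := S'.α₁) (y := E.hAut h034 * E.hAut h023 * E.hAut h012)
      [h034, h023, h012] [x, y, z] [p, q] [] _ (by simpa [mul_assoc] using hπ)
      (by simp [mul_assoc])]
  apply Additive.ofMul.injective
  simp only [← EquivalenceMaps.barAt_inv, inv_one, List.cons_append, List.nil_append,
    ofMul_mul, ofMul_inv]
  abel

/-- The two scalars of a 4-simplex differ by the defects of its five tetrahedra. -/
theorem simplexScalar_newLabel (E : TwoEquivalence S S') (a b c d : G)
    (h012 h013 h014 h023 h024 h034 h123 h124 h134 h234 : H)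
    (f0123 : h023 * h012 * S.α₀ b c d = h013 * h123)
    (f0124 : h024 * h012 * S.α₀ (a * b) c d = h014 * h124)
    (f0134 : h034 * h013 * S.α₀ a (b * c) d = h014 * h134)
    (f0234 : h034 * h023 * S.α₀ a b (c * d) = h024 * h234)
    (f1234 : h134 * h123 * S.α₀ a b c = h124 * h234) :
    simplexScalar S'.toStructureMaps (E.gAut a) (E.gAut b) (E.gAut c) (E.gAut d)
        (E.newLabel c d h012) (E.newLabel (b * c) d h013) (E.newLabel (a * (b * c)) d h014)
        (E.newLabel b (c * d) h023) (E.newLabel (a * b) (c * d) h024)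
        (E.newLabel a (b * (c * d)) h034) (E.newLabel b c h123) (E.newLabel (a * b) c h124)
        (E.newLabel a (b * c) h134) (E.newLabel a b h234) =
      E.uAut (simplexScalar S.toStructureMaps a b c d
          h012 h013 h014 h023 h024 h034 h123 h124 h134 h234) *
        E.defect a b (c * d) h034 h023 h024 h234 * E.defect (a * b) c d h024 h012 h014 h124 *
        (E.defect a b c h134 h123 h124 h234)⁻¹ * (E.defect a (b * c) d h034 h013 h014 h134)⁻¹ *
        (E.defect b c d h023 h012 h013 h123)⁻¹ := by
  have assoc₁ : a * b * c = a * (b * c) := mul_assoc a b c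
  have assoc₂ : b * c * d = b * (c * d) := mul_assoc b c d
  have fold : ∀ g g' h, E.hAut h * E.Φ g g' = E.newLabel g g' h := fun _ _ _ => rfl
  have n0123 := E.newLabel_flat f0123
  have n0124 := E.newLabel_flat f0124
  have n0134 := E.newLabel_flat f0134
  have n0234 := E.newLabel_flat f0234
  rw [assoc₁] at n0124
  rw [assoc₂] at n0134
  obtain ⟨n012, hn012⟩ : ∃ n, n = E.newLabel c d h012 := ⟨_, rfl⟩
  obtain ⟨n013, hn013⟩ : ∃ n, n = E.newLabel (b * c) d h013 := ⟨_, rfl⟩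
  obtain ⟨n014, hn014⟩ : ∃ n, n = E.newLabel (a * (b * c)) d h014 := ⟨_, rfl⟩
  obtain ⟨n023, hn023⟩ : ∃ n, n = E.newLabel b (c * d) h023 := ⟨_, rfl⟩
  obtain ⟨n024, hn024⟩ : ∃ n, n = E.newLabel (a * b) (c * d) h024 := ⟨_, rfl⟩
  obtain ⟨n034, hn034⟩ : ∃ n, n = E.newLabel a (b * (c * d)) h034 := ⟨_, rfl⟩
  obtain ⟨n123, hn123⟩ : ∃ n, n = E.newLabel b c h123 := ⟨_, rfl⟩
  obtain ⟨n124, hn124⟩ : ∃ n, n = E.newLabel (a * b) c h124 := ⟨_, rfl⟩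
  obtain ⟨n134, hn134⟩ : ∃ n, n = E.newLabel a (b * c) h134 := ⟨_, rfl⟩
  obtain ⟨n234, hn234⟩ : ∃ n, n = E.newLabel a b h234 := ⟨_, rfl⟩
  -- The barred letters, named so that the positions below stay short.
  obtain ⟨b012, hb012⟩ : ∃ n, n = E.hAut h012 := ⟨_, rfl⟩
  obtain ⟨b013, hb013⟩ : ∃ n, n = E.hAut h013 := ⟨_, rfl⟩
  obtain ⟨b014, hb014⟩ : ∃ n, n = E.hAut h014 := ⟨_, rfl⟩
  obtain ⟨b023, hb023⟩ : ∃ n, n = E.hAut h023 := ⟨_, rfl⟩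
  obtain ⟨b024, hb024⟩ : ∃ n, n = E.hAut h024 := ⟨_, rfl⟩
  obtain ⟨b034, hb034⟩ : ∃ n, n = E.hAut h034 := ⟨_, rfl⟩
  obtain ⟨b123, hb123⟩ : ∃ n, n = E.hAut h123 := ⟨_, rfl⟩
  obtain ⟨b124, hb124⟩ : ∃ n, n = E.hAut h124 := ⟨_, rfl⟩
  obtain ⟨b134, hb134⟩ : ∃ n, n = E.hAut h134 := ⟨_, rfl⟩
  obtain ⟨b234, hb234⟩ : ∃ n, n = E.hAut h234 := ⟨_, rfl⟩
  have solve : ∀ {k l a m n : H}, k * l * a = m * n → a = m * n * k⁻¹ * l⁻¹ := by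
    intro k l a m n h
    have e := congrArg Additive.ofMul h
    apply Additive.ofMul.injective
    simp only [ofMul_mul, ofMul_inv] at e ⊢
    linear_combination (norm := abel) e
  have s0123 := solve (by simpa only [map_mul] using congrArg E.hAut f0123)
  have s0124 := solve (by simpa only [map_mul] using congrArg E.hAut f0124)
  have s0134 := solve (by simpa only [map_mul] using congrArg E.hAut f0134)
  have s0234 := solve (by simpa only [map_mul] using congrArg E.hAut f0234)
  have t0124 := solve n0124
  have t0134 := solve n0134
  have t0234 := solve n0234
  -- Replace the identity of each tetrahedron, split the moves of new labels, and use the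
  -- conditions on `φ`, `ψ`, `χ` at the positions where they occur.
  refine
    have T0234 := E.tetrahedron_at f0234 (x := 1) (x₁ := n034) (x₂ := b034) (x₃ := b034 * b023)
      (y₁ := b024) (y₂ := n024) ?_ ?_ ?_ ?_ ?_
    have T0124 := E.tetrahedron_at f0124 (x := 1) (x₁ := n024) (x₂ := b024) (x₃ := b024 * b012)
      (y₁ := b014) (y₂ := n014) ?_ ?_ ?_ ?_ ?_
    have T1234 := E.tetrahedron_at f1234 (x := n014) (x₁ := n014 * n134) (x₂ := n014 * b134)
      (x₃ := n014 * b134 * b123) (y₁ := n014 * b124) (y₂ := n014 * n124) ?_ ?_ ?_ ?_ ?_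
    have T0134 := E.tetrahedron_at f0134 (x := 1) (x₁ := n034) (x₂ := b034) (x₃ := b034 * b013)
      (y₁ := b014) (y₂ := n014) ?_ ?_ ?_ ?_ ?_
    have T0123 := E.tetrahedron_at f0123 (x := n034) (x₁ := n034 * n023) (x₂ := n034 * b023)
      (x₃ := n034 * b023 * b012) (y₁ := n034 * b013) (y₂ := n034 * n013) ?_ ?_ ?_ ?_ ?_
    have M₃ := S'.moveAt_mul_right (S'.ι₃_mul (E.gAut a) (E.gAut b) (E.gAut (c * d))
      (E.hAut h012) (E.Φ c d)) (x := n034 * n023) (y := n024 * n234) (z := n034 * n023 * b012)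
      ?_ ?_
    have M₁ := S'.moveAt_mul_right (S'.ι₁_mul (E.gAut (a * b)) (E.gAut c) (E.gAut d)
      (E.hAut h234) (E.Φ a b)) (x := n024 * n012) (y := n014 * n124) (z := n024 * n012 * b234)
      ?_ ?_
    have M₂ := S'.moveAt_mul_right (S'.ι₂_mul (E.gAut a) (E.gAut (b * c)) (E.gAut d)
      (E.hAut h123) (E.Φ b c)) (x := n034 * n013) (y := n014 * n134) (z := n034 * n013 * b123)
      ?_ ?_
    have X₁ := S'.moveAt_mul_left (E.hAut h234) (E.Φ a b) (E.newLabel c d h012) (x := n024)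
      (y := n024 * n012) (z := n024 * b234) ?_ ?_
    have X₂ := S'.moveAt_mul_right (S'.hexagon₂ (E.Φ a b) (E.hAut h012) (E.Φ c d))
      (x := n024 * b234) (y := n024 * n234) (z := n024 * b234 * b012) ?_ ?_
    have X₃ := S'.moveAt_mul_right (S'.hexagon₂ (E.hAut h234) (E.hAut h012) (E.Φ c d))
      (x := n024) (y := n024 * b234) (z := n024 * b012) ?_ ?_
    have P₁ := E.prism_at (E.cond_ι₁ (a * b) c d h234) (x := b024 * b012)
      (x₁ := n014 * b124) (x₂ := b014 * b124) (x₃ := b024 * b012 * b234)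
      (y₁ := n024 * n012) (y₂ := n024 * b012) ?_ ?_ ?_ ?_ ?_
    have P₂ := E.prism_at (E.cond_ι₂ a (b * c) d h123) (x := b034 * b013)
      (x₁ := n014 * b134) (x₂ := b014 * b134) (x₃ := b034 * b013 * b123)
      (y₁ := n034 * n013) (y₂ := n034 * b013) ?_ ?_ ?_ ?_ ?_
    have P₃ := E.prism_at (E.cond_ι₃ a b (c * d) h012) (x := b034 * b023)
      (x₁ := n024 * b234) (x₂ := b024 * b234) (x₃ := b034 * b023 * b012)
      (y₁ := n034 * n023) (y₂ := n034 * b023) ?_ ?_ ?_ ?_ ?_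
    have Q := E.pentagon_at a b c d (x := b034 * b023 * b012) (p₁ := b014 * b134 * b123)
      (p₂ := n014 * b134 * b123) (p₃ := b034 * b013 * b123) (p₄ := n034 * n013 * b123)
      (p₅ := n034 * b023 * b012) (p₆ := n034 * n023 * n012) (q₁ := b024 * b012 * b234)
      (q₂ := n024 * n012 * b234) (q₃ := n024 * b234 * b012) (q₄ := n034 * n023 * b012)
      ?_ ?_ ?_ ?_ ?_ ?_ ?_ ?_ ?_ ?_
    have C := E.cond_τ_at b024 h234 h012
    have Wχ := E.move_word_at (t := E.χ a) (E.χ_mul a (b * (c * d))) f0123 (x := b034) (y := n034)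
      (z₁ := b034 * b023) (z₂ := b034 * b023 * b012) (z₃ := b034 * b013) ?_ ?_ ?_ ?_
    have Wψ := E.move_word_at (t := fun h => E.ψ h d) (E.ψ_mul (a * (b * c)) d) f1234 (x := b014) (y := n014)
      (z₁ := b014 * b134) (z₂ := b014 * b134 * b123) (z₃ := b014 * b124) ?_ ?_ ?_ ?_
    have Y := S'.moveAt_exchange (E.Φ (a * b) (c * d)) (E.hAut h234) (E.hAut h012)
      (E.ψ h234 (c * d)) (E.χ (a * b) h012) (S'.τ (E.hAut h234) (E.hAut h012))
      (x := b024) (y := n024) (z := b024 * b234) (w := b024 * b012) ?_ ?_ ?_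
    ?main
  case main =>
    have τ_inv : ∀ (x f g : H), moveAt S'.α₁ x f g (S'.τ g f)⁻¹ =
        (moveAt S'.α₁ x g f (S'.τ g f))⁻¹ := fun x f g => cellAt_inv _ _ _ _ _
    rw [SemiWeakStructure.simplexScalar_eq, E.uAut_simplexScalar a b c d _ _ _ _ _ _ _ _ _ _
      f0123 f0124 f0134 f0234 f1234]
    apply Additive.ofMul.injective
    replace T0234 := congrArg Additive.ofMul T0234
    replace T0124 := congrArg Additive.ofMul T0124
    replace T1234 := congrArg Additive.ofMul T1234
    replace T0134 := congrArg Additive.ofMul T0134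
    replace T0123 := congrArg Additive.ofMul T0123
    replace M₁ := congrArg Additive.ofMul M₁
    replace M₂ := congrArg Additive.ofMul M₂
    replace M₃ := congrArg Additive.ofMul M₃
    replace X₁ := congrArg Additive.ofMul X₁
    replace X₂ := congrArg Additive.ofMul X₂
    replace X₃ := congrArg Additive.ofMul X₃
    replace P₁ := congrArg Additive.ofMul P₁
    replace P₂ := congrArg Additive.ofMul P₂
    replace P₃ := congrArg Additive.ofMul P₃
    replace Q := congrArg Additive.ofMul Q
    replace C := congrArg Additive.ofMul C
    replace Wχ := congrArg Additive.ofMul Wχ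
    replace Wψ := congrArg Additive.ofMul Wψ
    replace Y := congrArg Additive.ofMul Y
    clear n0123 n0124 n0134 n0234 s0123 s0124 s0134 s0234 t0124 t0134 t0234 solve
      f0123 f0124 f0134 f0234 f1234
    simp only [fold] at M₁ M₂ M₃ X₁ X₂ X₃
    simp only [τ_inv, assoc₁, assoc₂, ← hn012, ← hn013, ← hn014, ← hn023, ← hn024, ← hn034,
      ← hn123, ← hn124, ← hn134, ← hn234, ← hb012, ← hb013, ← hb014, ← hb023, ← hb024, ← hb034,
      ← hb123, ← hb124, ← hb134, ← hb234, map_mul E.gAut, ofMul_mul, ofMul_inv]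
      at T0234 T0124 T1234 T0134 T0123 M₁ M₂ M₃ X₁ X₂ X₃ P₁ P₂ P₃ Q C Wχ Wψ Y ⊢
    linear_combination (norm := abel) T0234 + T0124 - T1234 - T0134 - T0123 - M₃ - M₁ + M₂
      + X₁ + X₂ + X₃ + P₁ - P₂ + P₃ + Q - C - Wχ - Wψ - Y
  all_goals
    try simp only [s0123, s0124, s0134, s0234, t0124, t0134, t0234]
    subst_vars
    apply Additive.ofMul.injective
    simp only [newLabel, assoc₁, assoc₂, ofMul_mul, ofMul_inv, ofMul_one] <;>
    abel

end TwoEquivalence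

end Simplex

/-! ### Combinatorial spheres are cycles modulo 2 -/

section Cofaces

/-- The vertices that span, together with `t`, a face of `K` of one dimension more. -/
def cofaces {V : Type*} [DecidableEq V] (K : PreAbstractSimplicialComplex V) (t : Finset V) :
    Set V :=
  {v | v ∉ t ∧ insert v t ∈ K.faces}

/-- `K` has dimension at most `n`, and the sum of its `n`-simplices is a cycle modulo 2. If an
`(n - 1)`-simplex has infinitely many cofaces, its degree counts as zero. -/
def IsEvenCycle {V : Type*} [DecidableEq V] (n : ℕ) (K : PreAbstractSimplicialComplex V) : Prop :=
  (∀ t ∈ K.faces, t.card ≤ n + 1) ∧ ∀ t : Finset V, t.card = n → Even (cofaces K t).ncard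

namespace IsStarring

variable {K L : PreAbstractSimplicialComplex ℕ} {s : Finset ℕ} {a : ℕ}

theorem new_notMem (h : IsStarring K L s a) {t : Finset ℕ} (ht : t ∈ K.faces) : a ∉ t := fun hat =>
  h.2.1 ((K.isRelLowerSet_faces ht).2 (Finset.singleton_subset_iff.2 hat)
    (Finset.singleton_nonempty a))

theorem nonempty (h : IsStarring K L s a) : s.Nonempty := (K.isRelLowerSet_faces h.1).1

theorem mem_cofaces (h : IsStarring K L s a) {t : Finset ℕ} (ha : a ∉ t) (v : ℕ) :
    v ∈ cofaces L t ↔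
      (v ∈ cofaces K t ∧ ¬ s ⊆ insert v t) ∨ (v = a ∧ ¬ s ⊆ t ∧ t ∪ s ∈ K.faces) := by
  simp only [cofaces, Set.mem_ofPred_eq, h.2.2]
  constructor
  · rintro ⟨hv, h' | ⟨u, hu, hsu, hK⟩⟩
    · exact Or.inl ⟨⟨hv, h'.1⟩, h'.2⟩
    · have hau : a ∉ u := fun hau => h.new_notMem hK (Finset.mem_union_left _ hau)
      have hav : a = v := by
        have : a ∈ insert v t := hu ▸ Finset.mem_insert_self a u
        exact (Finset.mem_insert.1 this).resolve_right ha
      subst hav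
      have : t = u := by
        rw [← Finset.erase_insert ha, hu, Finset.erase_insert hau]
      subst this
      exact Or.inr ⟨rfl, hsu, hK⟩
  · rintro (⟨⟨hv, hK⟩, hs⟩ | ⟨rfl, hs, hK⟩)
    · exact ⟨hv, Or.inl ⟨hK, hs⟩⟩
    · exact ⟨ha, Or.inr ⟨t, rfl, hs, hK⟩⟩

theorem mem_cofaces_insert (h : IsStarring K L s a) {u : Finset ℕ} (ha : a ∉ u) (v : ℕ) :
    v ∈ cofaces L (insert a u) ↔
      v ∉ insert a u ∧ ¬ s ⊆ insert v u ∧ insert v u ∪ s ∈ K.faces := by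
  simp only [cofaces, Set.mem_ofPred_eq, h.2.2]
  refine and_congr_right fun hv => ?_
  have hva : a ∉ insert v u := fun h' => (Finset.mem_insert.1 h').elim
    (fun e => hv (e ▸ Finset.mem_insert_self _ _)) ha
  constructor
  · rintro (h' | ⟨w, hw, hsw, hK⟩)
    · exact (h.new_notMem h'.1 (by simp)).elim
    · have haw : a ∉ w := fun haw => h.new_notMem hK (Finset.mem_union_left _ haw)
      have : insert v u = w := by
        rw [← Finset.erase_insert hva, Finset.insert_comm, hw, Finset.erase_insert haw]
      subst this
      exact ⟨hsw, hK⟩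
  · rintro ⟨hs, hK⟩
    exact Or.inr ⟨insert v u, Finset.insert_comm _ _ _, hs, hK⟩

theorem card_le_iff (h : IsStarring K L s a) (m : ℕ) :
    (∀ t ∈ K.faces, t.card ≤ m) ↔ ∀ t ∈ L.faces, t.card ≤ m := by
  constructor
  · intro hK t ht
    rcases (h.2.2 t).1 ht with ht | ⟨u, rfl, hsu, hu⟩
    · exact hK t ht.1
    · have h₁ : u.card < (u ∪ s).card := Finset.card_lt_card
        (Finset.ssubset_iff_subset_ne.2 ⟨Finset.subset_union_left, fun e =>
          hsu (e ▸ Finset.subset_union_right)⟩)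
      have h₂ := hK _ hu
      have h₃ := Finset.card_insert_le a u
      omega
  · intro hL t ht
    by_cases hst : s ⊆ t
    · obtain ⟨x, hx⟩ := h.nonempty
      have hat : a ∉ t.erase x := fun h' => h.new_notMem ht (Finset.mem_of_mem_erase h')
      have hmem : insert a (t.erase x) ∈ L.faces := by
        refine (h.2.2 _).2 (Or.inr ⟨t.erase x, rfl, fun h' => Finset.notMem_erase x t (h' hx), ?_⟩)
        have : t.erase x ∪ s = t := by
          ext y
          by_cases hy : y = x
          · subst hy; simp [hx, hst hx]
          · simp only [Finset.mem_union, Finset.mem_erase]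
            exact ⟨fun h' => h'.elim (·.2) (fun h' => hst h'), fun h' => Or.inl ⟨hy, h'⟩⟩
        rwa [this]
      have h₁ := hL _ hmem
      rw [Finset.card_insert_of_notMem hat, Finset.card_erase_add_one (hst hx)] at h₁
      exact h₁
    · exact hL t ((h.2.2 t).2 (Or.inl ⟨ht, hst⟩))

/-- The new vertex replaces the one vertex of `s` that is missing in `t`. -/
theorem ncard_cofaces (h : IsStarring K L s a) {n : ℕ} (hd : ∀ t ∈ K.faces, t.card ≤ n + 1)
    {t : Finset ℕ} (hn : t.card = n) (ha : a ∉ t) (hs : ¬ s ⊆ t) :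
    (cofaces L t).ncard = (cofaces K t).ncard := by
  have hunion : ∀ v, v ∉ t → s ⊆ insert v t → insert v t = t ∪ s := by
    intro v hv hsv
    obtain ⟨y, hy, hyt⟩ := Finset.not_subset.1 hs
    have hyv : y = v := (Finset.mem_insert.1 (hsv hy)).resolve_right hyt
    subst hyv
    exact (Finset.insert_subset (Finset.mem_union_right _ hy) Finset.subset_union_left).antisymm
      (Finset.union_subset (Finset.subset_insert _ _) hsv)
  by_cases hts : t ∪ s ∈ K.faces
  · obtain ⟨x, hx, hxt⟩ := Finset.not_subset.1 hs
    have hins : insert x t = t ∪ s := by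
      refine Finset.eq_of_subset_of_card_le (Finset.insert_subset (Finset.mem_union_right _ hx)
        Finset.subset_union_left) ?_
      rw [Finset.card_insert_of_notMem hxt, hn]
      exact hd _ hts
    have hxa : x ≠ a := fun e => h.new_notMem h.1 (e ▸ hx)
    rw [← Set.ncard_image_of_injective (cofaces K t) (Equiv.swap a x).injective]
    congr 1
    ext v
    rw [Set.mem_image_equiv, Equiv.symm_swap]
    by_cases hva : v = a
    · subst hva
      rw [Equiv.swap_apply_left, h.mem_cofaces ha]
      exact iff_of_true (Or.inr ⟨rfl, hs, hts⟩) ⟨hxt, hins ▸ hts⟩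
    · by_cases hvx : v = x
      · subst hvx
        rw [Equiv.swap_apply_right, h.mem_cofaces ha]
        refine iff_of_false ?_ fun h' => h.new_notMem h'.2 (Finset.mem_insert_self _ _)
        rintro (⟨-, h'⟩ | ⟨h', -⟩)
        · exact h' (hins ▸ Finset.subset_union_right)
        · exact hva h'
      · rw [Equiv.swap_apply_of_ne_of_ne hva hvx, h.mem_cofaces ha]
        refine ⟨fun h' => h'.elim (·.1) fun h' => (hva h'.1).elim, fun h' => Or.inl ⟨h', ?_⟩⟩
        intro hsv
        exact (Finset.mem_insert.1 (hsv hx)).elim (fun e => hvx e.symm) hxt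
  · congr 1
    ext v
    rw [h.mem_cofaces ha]
    refine ⟨fun h' => h'.elim (·.1) fun h' => (hts h'.2.2).elim, fun h' => Or.inl ⟨h', ?_⟩⟩
    exact fun hsv => hts (hunion v h'.1 hsv ▸ h'.2)

theorem cofaces_insert_erase (h : IsStarring K L s a) {t : Finset ℕ} (ha : a ∉ t) (hs : s ⊆ t)
    {x : ℕ} (hx : x ∈ s) : cofaces L (insert a (t.erase x)) = cofaces K t := by
  ext v
  rw [h.mem_cofaces_insert (fun h' => ha (Finset.mem_of_mem_erase h'))]
  have key : insert v (t.erase x) ∪ s = insert v t := by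
    ext y
    by_cases hy : y = x
    · subst hy; simp [hx, hs hx]
    · simp only [Finset.mem_union, Finset.mem_insert, Finset.mem_erase]
      constructor
      · rintro ((h' | h') | h')
        exacts [Or.inl h', Or.inr h'.2, Or.inr (hs h')]
      · rintro (h' | h')
        exacts [Or.inl (Or.inl h'), Or.inl (Or.inr ⟨hy, h'⟩)]
  rw [key]
  constructor
  · rintro ⟨hv, hsv, hK⟩
    refine ⟨fun hvt => ?_, hK⟩
    have hvx : v = x := by
      by_contra hne
      exact hv (Finset.mem_insert_of_mem (Finset.mem_erase.2 ⟨hne, hvt⟩))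
    subst hvx
    exact hsv (by rwa [Finset.insert_erase hvt])
  · rintro ⟨hv, hK⟩
    refine ⟨fun h' => ?_, fun h' => ?_, hK⟩
    · rcases Finset.mem_insert.1 h' with rfl | h'
      · exact h.new_notMem hK (Finset.mem_insert_self _ _)
      · exact hv (Finset.mem_of_mem_erase h')
    · rcases Finset.mem_insert.1 (h' hx) with rfl | h''
      · exact hv (hs hx)
      · exact Finset.notMem_erase x t h''

/-- If two vertices of `s` are missing in `u`, these are the only possible cofaces of the simplex
spanned by `u` and the new vertex, and both or none of them occur. -/
theorem even_cofaces_insert (h : IsStarring K L s a) {n : ℕ} (hd : ∀ t ∈ K.faces, t.card ≤ n + 1)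
    {u : Finset ℕ} (hn : u.card + 1 = n) (ha : a ∉ u) (hs : 2 ≤ (s \ u).card) :
    Even (cofaces L (insert a u)).ncard := by
  rcases (cofaces L (insert a u)).eq_empty_or_nonempty with he | ⟨v, hv⟩
  · simp [he]
  rw [h.mem_cofaces_insert ha] at hv
  obtain ⟨hv, -, hK⟩ := hv
  have hsu : u ∪ s = insert v u ∪ s := by
    refine Finset.eq_of_subset_of_card_le
      (Finset.union_subset_union_left (Finset.subset_insert v u)) ((hd _ hK).trans ?_)
    rw [Finset.union_comm, ← Finset.card_sdiff_add_card]
    omega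
  have hsu' : (s \ u).card = 2 := by
    have h₁ := hd _ hK
    rw [← hsu, Finset.union_comm, ← Finset.card_sdiff_add_card] at h₁
    omega
  rw [← hsu] at hK
  have hset : cofaces L (insert a u) = ((s \ u : Finset ℕ) : Set ℕ) := by
    ext w
    rw [h.mem_cofaces_insert ha, Finset.mem_coe, Finset.mem_sdiff]
    constructor
    · rintro ⟨hw, -, hKw⟩
      have hwu : w ∉ u := fun h' => hw (Finset.mem_insert_of_mem h')
      refine ⟨?_, hwu⟩
      by_contra hws
      have h₁ := hd _ hKw
      have h₂ : insert w u ∪ s = insert w (u ∪ s) := by rw [Finset.insert_union]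
      rw [h₂, Finset.card_insert_of_notMem (by simp [hws, hwu]), Finset.union_comm,
        ← Finset.card_sdiff_add_card] at h₁
      omega
    · rintro ⟨hws, hwu⟩
      refine ⟨?_, fun hsw => ?_, ?_⟩
      · rw [Finset.mem_insert]
        rintro (rfl | h')
        exacts [h.new_notMem h.1 hws, hwu h']
      · have : s \ u ⊆ {w} := fun y hy => by
          rw [Finset.mem_sdiff] at hy
          exact Finset.mem_singleton.2 ((Finset.mem_insert.1 (hsw hy.1)).resolve_right hy.2)
        have := Finset.card_le_card this
        rw [Finset.card_singleton] at this
        omega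
      · rwa [Finset.insert_union, Finset.insert_eq_of_mem (Finset.mem_union_right _ hws)]
  rw [hset, Set.ncard_coe_finset, hsu']
  exact even_two

theorem isEvenCycle_iff (h : IsStarring K L s a) (n : ℕ) : IsEvenCycle n K ↔ IsEvenCycle n L := by
  constructor
  · rintro ⟨hd, hK⟩
    refine ⟨(h.card_le_iff _).1 hd, fun t hn => ?_⟩
    by_cases ha : a ∈ t
    · obtain ⟨u, hau, rfl⟩ : ∃ u, a ∉ u ∧ t = insert a u :=
        ⟨t.erase a, Finset.notMem_erase a t, (Finset.insert_erase ha).symm⟩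
      rw [Finset.card_insert_of_notMem hau] at hn
      rcases Nat.lt_or_ge (s \ u).card 2 with hlt | hge
      · by_cases hsu : s ⊆ u
        · have : cofaces L (insert a u) = ∅ := by
            ext v
            rw [h.mem_cofaces_insert hau]
            exact iff_of_false (fun h' => h'.2.1 (hsu.trans (Finset.subset_insert _ _))) id
          simp [this]
        · have hpos : (s \ u).Nonempty := Finset.sdiff_nonempty.2 hsu
          obtain ⟨x, hx⟩ := Finset.card_eq_one.1 (show (s \ u).card = 1 from by
            have := hpos.card_pos; omega)
          have hxm : x ∈ s \ u := hx ▸ Finset.mem_singleton_self x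
          rw [Finset.mem_sdiff] at hxm
          have hsx : s ⊆ insert x u := fun y hy => by
            by_cases hyu : y ∈ u
            · exact Finset.mem_insert_of_mem hyu
            · have : y ∈ s \ u := Finset.mem_sdiff.2 ⟨hy, hyu⟩
              rw [hx, Finset.mem_singleton] at this
              exact this ▸ Finset.mem_insert_self _ _
          have hax : a ∉ insert x u := by
            rw [Finset.mem_insert]
            rintro (rfl | h')
            exacts [h.new_notMem h.1 hxm.1, hau h']
          have := h.cofaces_insert_erase hax hsx hxm.1
          rw [Finset.erase_insert hxm.2] at this
          rw [this]
          exact hK _ (by rw [Finset.card_insert_of_notMem hxm.2, hn])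
      · exact h.even_cofaces_insert hd hn hau hge
    · by_cases hst : s ⊆ t
      · have : cofaces L t = ∅ := by
          ext v
          rw [h.mem_cofaces ha]
          refine iff_of_false ?_ id
          rintro (⟨-, h'⟩ | ⟨-, h', -⟩)
          exacts [h' (hst.trans (Finset.subset_insert _ _)), h' hst]
        simp [this]
      · rw [h.ncard_cofaces hd hn ha hst]
        exact hK t hn
  · rintro ⟨hd, hL⟩
    have hdK := (h.card_le_iff _).2 hd
    refine ⟨hdK, fun t hn => ?_⟩
    by_cases ha : a ∈ t
    · have : cofaces K t = ∅ := by
        ext v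
        exact iff_of_false
          (fun h' => h.new_notMem h'.2 (Finset.mem_insert_of_mem ha)) id
      simp [this]
    · by_cases hst : s ⊆ t
      · obtain ⟨x, hx⟩ := h.nonempty
        rw [← h.cofaces_insert_erase ha hst hx]
        refine hL _ ?_
        rw [Finset.card_insert_of_notMem (fun h' => ha (Finset.mem_of_mem_erase h')),
          Finset.card_erase_add_one (hst hx), hn]
      · rw [← h.ncard_cofaces hdK hn ha hst]
        exact hL t hn

end IsStarring

theorem isEvenCycle_simplexBoundary (n : ℕ) : IsEvenCycle n (simplexBoundary (n + 1)) := by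
  constructor
  · rintro t ⟨-, ht⟩
    have := Finset.card_lt_card ht
    rw [Finset.card_range] at this
    omega
  · intro t hn
    by_cases ht : t ⊆ Finset.range (n + 1 + 1)
    · have : cofaces (simplexBoundary (n + 1)) t =
          ((Finset.range (n + 1 + 1) \ t : Finset ℕ) : Set ℕ) := by
        ext v
        rw [Finset.mem_coe, Finset.mem_sdiff]
        constructor
        · rintro ⟨hv, -, hvt⟩
          exact ⟨hvt.1 (Finset.mem_insert_self _ _), hv⟩
        · rintro ⟨hv, hvt⟩
          refine ⟨hvt, Finset.insert_nonempty _ _, Finset.ssubset_iff_subset_ne.2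
            ⟨Finset.insert_subset hv ht, fun e => ?_⟩⟩
          have := congrArg Finset.card e
          rw [Finset.card_insert_of_notMem hvt, Finset.card_range] at this
          omega
      rw [this, Set.ncard_coe_finset, Finset.card_sdiff_of_subset ht, Finset.card_range, hn]
      exact ⟨1, by omega⟩
    · have : cofaces (simplexBoundary (n + 1)) t = ∅ := by
        ext v
        exact iff_of_false
          (fun h => ht ((Finset.subset_insert v t).trans h.2.2.1)) id
      simp [this]

theorem StellarEquivalent.isEvenCycle_iff {K L : PreAbstractSimplicialComplex ℕ}
    (h : StellarEquivalent K L) (n : ℕ) : IsEvenCycle n K ↔ IsEvenCycle n L := by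
  induction h with
  | rel K L h =>
    obtain ⟨s, a, h⟩ := h
    exact h.isEvenCycle_iff n
  | refl K => rfl
  | symm K L _ ih => exact ih.symm
  | trans K L M _ _ ih₁ ih₂ => exact ih₁.trans ih₂

theorem cofaces_map {V : Type*} [DecidableEq V] (K : PreAbstractSimplicialComplex V) {f : V → ℕ}
    (hf : Function.Injective f) (t : Finset V) :
    cofaces (K.map f) (t.image f) = f '' cofaces K t := by
  ext w
  constructor
  · rintro ⟨hw, s, hs, hst⟩
    have hws : w ∈ s.image f := by
      rw [show s.image f = insert w (t.image f) from hst]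
      exact Finset.mem_insert_self _ _
    obtain ⟨v, hv, rfl⟩ := Finset.mem_image.1 hws
    have hst' : s = insert v t := by
      apply Finset.image_injective hf
      rw [Finset.image_insert]
      exact hst
    refine ⟨v, ⟨fun h => hw (Finset.mem_image_of_mem f h), ?_⟩, rfl⟩
    exact hst' ▸ hs
  · rintro ⟨v, ⟨hv, hK⟩, rfl⟩
    refine ⟨fun h => hv ?_, insert v t, hK, Finset.image_insert _ _ _⟩
    obtain ⟨v', hv', e⟩ := Finset.mem_image.1 h
    exact hf e ▸ hv'

theorem IsCombinatorialSphere.even_cofaces {V : Type*} [DecidableEq V] {n : ℕ}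
    {K : PreAbstractSimplicialComplex V} (h : IsCombinatorialSphere n K) {t : Finset V}
    (ht : t.card = n) : Even (cofaces K t).ncard := by
  obtain ⟨f, hf, hK⟩ := h
  have := ((hK.isEvenCycle_iff n).2 (isEvenCycle_simplexBoundary n)).2 (t.image f)
    (by rw [Finset.card_image_of_injective _ hf, ht])
  rwa [cofaces_map K hf t, Set.ncard_image_of_injective _ hf] at this

theorem cofaces_vertexLink {V : Type*} [DecidableEq V] (K : AbstractSimplicialComplex V) {v : V}
    {t : Finset V} (hv : v ∉ t) :
    cofaces (vertexLink K v) t = cofaces K.toPreAbstractSimplicialComplex (insert v t) := by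
  ext w
  constructor
  · rintro ⟨hw, -, hvw, hK⟩
    refine ⟨fun h => ?_, by rw [Finset.insert_comm]; exact hK⟩
    rcases Finset.mem_insert.1 h with rfl | h
    exacts [hvw (Finset.mem_insert_self _ _), hw h]
  · rintro ⟨hw, hK⟩
    refine ⟨fun h => hw (Finset.mem_insert_of_mem h), Finset.insert_nonempty _ _, fun h => ?_, ?_⟩
    · rcases Finset.mem_insert.1 h with rfl | h
      exacts [hw (Finset.mem_insert_self _ _), hv h]
    · rw [Finset.insert_comm]; exact hK

theorem TriangulatedFourManifold.even_cofaces {V : Type*} [Fintype V] [DecidableEq V]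
    (T : TriangulatedFourManifold V) {t : Finset V} (ht : t.card = 4) :
    Even (cofaces T.complex.toPreAbstractSimplicialComplex t).ncard := by
  obtain ⟨v, hv⟩ : t.Nonempty := Finset.card_pos.1 (by omega)
  rw [← Finset.insert_erase hv, ← cofaces_vertexLink _ (Finset.notMem_erase v t)]
  exact (T.link_sphere v).even_cofaces (by rw [Finset.card_erase_of_mem hv, ht])

end Cofaces

/-! ### Cancellation of the contributions of the tetrahedra -/

section Boundary

variable {V : Type*} [LinearOrder V]

/-- The vertices of the tetrahedron `t` in increasing order, with `x` in front. -/
def consVertex (t : Finset V) (ht : t.card = 4) (x : V) : Fin 5 → V :=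
  Fin.cons x (t.orderEmbOfFin ht)

theorem image_consVertex (t : Finset V) (ht : t.card = 4) (x : V) :
    Finset.univ.image (consVertex t ht x) = insert x t := by
  apply Finset.coe_injective
  rw [Finset.coe_image, Finset.coe_univ, Set.image_univ, consVertex, Fin.range_cons,
    Finset.range_orderEmbOfFin, Finset.coe_insert]

theorem enumerates_consVertex {K : AbstractSimplicialComplex V} {t : Finset V} (ht : t.card = 4)
    {x : V} (hx : x ∈ cofaces K.toPreAbstractSimplicialComplex t) :
    Enumerates K (consVertex t ht x) := by
  refine ⟨?_, by rw [image_consVertex]; exact hx.2⟩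
  rw [consVertex, Fin.cons_injective_iff]
  refine ⟨?_, (t.orderEmbOfFin ht).injective⟩
  rw [Finset.range_orderEmbOfFin]
  exact hx.1

theorem orderedVertices_strictMono {K : AbstractSimplicialComplex V} (s : KSimplex K 4) :
    StrictMono (orderedVertices s) := (s.1.orderEmbOfFin s.2.2).strictMono

theorem image_orderedVertices {K : AbstractSimplicialComplex V} (s : KSimplex K 4) :
    Finset.univ.image (orderedVertices s) = s.1 := by
  apply Finset.coe_injective
  rw [Finset.coe_image, Finset.coe_univ, Set.image_univ, orderedVertices,
    Finset.range_orderEmbOfFin]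

theorem enumerates_orderedVertices {K : AbstractSimplicialComplex V} (s : KSimplex K 4) :
    Enumerates K (orderedVertices s) :=
  ⟨(orderedVertices_strictMono s).injective, by rw [image_orderedVertices]; exact s.2.1⟩

theorem orderedVertices_succAbove {K : AbstractSimplicialComplex V} (s : KSimplex K 4)
    (i : Fin 5) (h : (s.1.erase (orderedVertices s i)).card = 4) :
    orderedVertices s ∘ i.succAbove = (s.1.erase (orderedVertices s i)).orderEmbOfFin h := by
  refine Finset.orderEmbOfFin_unique h (fun j => ?_)
    ((orderedVertices_strictMono s).comp (Fin.strictMono_succAbove i))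
  refine Finset.mem_erase.2 ⟨fun e => Fin.succAbove_ne i j
    ((orderedVertices_strictMono s).injective e), ?_⟩
  exact Finset.orderEmbOfFin_mem _ _ _

variable [Fintype V]

/-- Moving the `i`-th vertex to the front changes the orientation by `(-1)^i`. -/
theorem orient_consVertex (T : TriangulatedFourManifold V) (s : KSimplex T.complex 4) (i : Fin 5)
    (h : (s.1.erase (orderedVertices s i)).card = 4) :
    T.orient (consVertex (s.1.erase (orderedVertices s i)) h (orderedVertices s i)) =
      (-1) ^ (i : ℕ) * T.orient (orderedVertices s) := by
  rw [← Fin.sign_cycleRange, ← Equiv.Perm.sign_symm,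
    ← T.orient_perm _ (enumerates_orderedVertices s)]
  congr 1
  rw [consVertex, ← orderedVertices_succAbove]
  funext j
  refine Fin.cases ?_ (fun j => ?_) j
  · rw [Fin.cons_zero, Function.comp_apply, Fin.cycleRange_symm_zero]
  · rw [Fin.cons_succ, Function.comp_apply, Function.comp_apply, Fin.cycleRange_symm_succ]

/-- Signs that are pairwise opposite on a set of even size add up to zero: such a set has at most
two elements. -/
theorem sum_eq_zero_of_pairwise_neg {ι : Type*} (A : Finset ι) (e : ι → ℤˣ)
    (hA : Even A.card) (he : ∀ x ∈ A, ∀ y ∈ A, x ≠ y → e y = - e x) :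
    ∑ x ∈ A, ((e x : ℤˣ) : ℤ) = 0 := by
  classical
  rcases A.eq_empty_or_nonempty with rfl | ⟨x, hx⟩
  · simp
  obtain ⟨y, hy⟩ : (A.erase x).Nonempty := by
    rw [← Finset.card_pos, Finset.card_erase_of_mem hx]
    obtain ⟨k, hk⟩ := hA
    have := Finset.card_pos.2 ⟨x, hx⟩
    omega
  rw [Finset.mem_erase] at hy
  have hA2 : A = {x, y} := by
    refine Finset.Subset.antisymm (fun z hz => ?_) (by simp [Finset.insert_subset_iff, hx, hy.2])
    by_contra hzxy
    simp only [Finset.mem_insert, Finset.mem_singleton, not_or] at hzxy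
    have h₁ := he x hx z hz (Ne.symm hzxy.1)
    have h₂ := he y hy.2 z hz (Ne.symm hzxy.2)
    have h₃ := he x hx y hy.2 (Ne.symm hy.1)
    rw [h₂, h₃, neg_neg] at h₁
    exact units_ne_neg_self _ h₁
  rw [hA2, Finset.sum_pair (Ne.symm hy.1), he x hx y hy.2 (Ne.symm hy.1)]
  simp

theorem sum_orient_cofaces (T : TriangulatedFourManifold V) {t : Finset V} (ht : t.card = 4)
    (A : Finset V) (hA : (A : Set V) = cofaces T.complex.toPreAbstractSimplicialComplex t) :
    ∑ x ∈ A, ((T.orient (consVertex t ht x) : ℤˣ) : ℤ) = 0 := by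
  refine sum_eq_zero_of_pairwise_neg A _ ?_ fun x hx y hy hxy => ?_
  · rw [← Set.ncard_coe_finset, hA]
    exact T.even_cofaces ht
  · have hx' : x ∈ cofaces T.complex.toPreAbstractSimplicialComplex t := hA ▸ hx
    have hy' : y ∈ cofaces T.complex.toPreAbstractSimplicialComplex t := hA ▸ hy
    exact T.orient_coherent _ _ (enumerates_consVertex ht hx') (enumerates_consVertex ht hy')
      (fun i => rfl) hxy

/-- The fundamental chain is a cycle: a product over the boundary tetrahedra of all 4-simplices,
with signs, is trivial. -/
theorem prod_boundary {M : Type*} [CommGroup M] (T : TriangulatedFourManifold V)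
    (θ : (Fin 4 → V) → M) :
    ∏ s : KSimplex T.complex 4, ∏ i : Fin 5, θ (orderedVertices s ∘ i.succAbove) ^
      (((-1) ^ (i : ℕ) * T.orient (orderedVertices s) : ℤˣ) : ℤ) = 1 := by
  classical
  have hcard : ∀ (s : KSimplex T.complex 4) (i : Fin 5),
      (s.1.erase (orderedVertices s i)).card = 4 := fun s i => by
    have hmem : orderedVertices s i ∈ s.1 := Finset.orderEmbOfFin_mem _ _ _
    rw [Finset.card_erase_of_mem hmem, s.2.2]
  have hzpow : ∀ (A : Finset V) (g : M) (e : V → ℤ), ∏ x ∈ A, g ^ e x = g ^ ∑ x ∈ A, e x :=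
    fun A g e => by
      induction A using Finset.induction_on with
      | empty => simp
      | insert x A hx ih => rw [Finset.prod_insert hx, Finset.sum_insert hx, zpow_add, ih]
  have hfin : ∀ t : Finset V,
      ((Finset.univ.filter fun x => x ∈ cofaces T.complex.toPreAbstractSimplicialComplex t :
        Finset V) : Set V) = cofaces T.complex.toPreAbstractSimplicialComplex t :=
    fun t => by ext; simp
  calc
    _ = ∏ p : (_ : KSimplex T.complex 4) × Fin 5,
          θ ((p.1.1.erase (orderedVertices p.1 p.2)).orderEmbOfFin (hcard p.1 p.2)) ^
            ((T.orient (consVertex (p.1.1.erase (orderedVertices p.1 p.2)) (hcard p.1 p.2)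
              (orderedVertices p.1 p.2)) : ℤˣ) : ℤ) := by
        rw [Fintype.prod_sigma]
        refine Finset.prod_congr rfl fun s _ => Finset.prod_congr rfl fun i _ => ?_
        rw [orient_consVertex T s i, orderedVertices_succAbove s i (hcard s i)]
    _ = ∏ q ∈ (Finset.univ : Finset {t : Finset V // t.card = 4}).sigma fun t =>
          Finset.univ.filter fun x => x ∈ cofaces T.complex.toPreAbstractSimplicialComplex t.1,
          θ (q.1.1.orderEmbOfFin q.1.2) ^ ((T.orient (consVertex q.1.1 q.1.2 q.2) : ℤˣ) : ℤ) := by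
        refine Finset.prod_bij (fun p _ => ⟨⟨_, hcard p.1 p.2⟩, orderedVertices p.1 p.2⟩)
          ?_ ?_ ?_ ?_
        · intro p _
          have hmem : orderedVertices p.1 p.2 ∈ p.1.1 := Finset.orderEmbOfFin_mem _ _ _
          simp only [Finset.mem_sigma, Finset.mem_univ, true_and, Finset.mem_filter]
          refine ⟨Finset.notMem_erase _ _, ?_⟩
          rw [Finset.insert_erase hmem]
          exact p.1.2.1
        · rintro ⟨s, i⟩ _ ⟨s', i'⟩ _ h
          simp only [Sigma.mk.injEq, Subtype.mk.injEq, heq_eq_eq] at h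
          have hmem : orderedVertices s i ∈ s.1 := Finset.orderEmbOfFin_mem _ _ _
          have hmem' : orderedVertices s' i' ∈ s'.1 := Finset.orderEmbOfFin_mem _ _ _
          have hs : s = s' := by
            apply Subtype.ext
            rw [← Finset.insert_erase hmem, h.1, h.2, Finset.insert_erase hmem']
          subst hs
          rw [(orderedVertices_strictMono s).injective h.2]
        · rintro ⟨⟨t, ht⟩, x⟩ hx
          simp only [Finset.mem_sigma, Finset.mem_univ, true_and, Finset.mem_filter] at hx
          let s : KSimplex T.complex 4 :=
            ⟨insert x t, hx.2, by rw [Finset.card_insert_of_notMem hx.1, ht]⟩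
          obtain ⟨i, hi⟩ : ∃ i, orderedVertices s i = x := by
            have : x ∈ Set.range (orderedVertices s) := by
              rw [orderedVertices, Finset.range_orderEmbOfFin]
              exact Finset.mem_insert_self _ _
            exact this
          refine ⟨⟨s, i⟩, Finset.mem_univ _, ?_⟩
          have : s.1.erase x = t := Finset.erase_insert hx.1
          simp only [hi, this]
        · intro p _
          rfl
    _ = 1 := by
        rw [Finset.prod_sigma]
        refine Finset.prod_eq_one fun t _ => ?_
        refine (hzpow _ (θ (t.1.orderEmbOfFin t.2))
          fun x => ((T.orient (consVertex t.1 t.2 x) : ℤˣ) : ℤ)).trans ?_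
        rw [sum_orient_cofaces T t.2 _ (hfin t.1), zpow_zero]

end Boundary

/-! ### The bijection of labellings -/

section Labellings

/-- The label of the edge `(ij)` that an edge labelling determines. -/
noncomputable def edgeLabel {G V : Type*} [Group G] {K : AbstractSimplicialComplex V}
    (g : KSimplex K 1 → G) (i j : V) : G :=
  Labelling.g (H := Unit) (g, fun _ => ()) i j

theorem edgeLabel_fst {G H V : Type*} [Group G] {K : AbstractSimplicialComplex V}
    (l : Labelling G H K) (i j : V) : edgeLabel l.1 i j = l.g i j := rfl

variable {G H R V : Type*} [Group G] [CommGroup H] [CommRing R] [StarRing R] [LinearOrder V]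
  {S S' : SemiWeakStructure G H R}

namespace TwoEquivalence

/-- The bijection of labellings that a 2-equivalence induces: edges are relabelled by the
automorphism of `G`, triangles by `newLabel`. -/
noncomputable def relabel (E : TwoEquivalence S S') (K : AbstractSimplicialComplex V) :
    Labelling G H K ≃ Labelling G H K :=
  Equiv.prodShear (Equiv.piCongrRight fun _ => E.gAut.toEquiv) fun g =>
    Equiv.piCongrRight fun t => E.hAut.toEquiv.trans (Equiv.mulRight
      (E.Φ (edgeLabel g (t.1.orderEmbOfFin t.2.2 1) (t.1.orderEmbOfFin t.2.2 2))
        (edgeLabel g (t.1.orderEmbOfFin t.2.2 0) (t.1.orderEmbOfFin t.2.2 1))))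

theorem relabel_g (E : TwoEquivalence S S') {K : AbstractSimplicialComplex V}
    (l : Labelling G H K) (i j : V) : (E.relabel K l).g i j = E.gAut (l.g i j) := by
  unfold Labelling.g
  split_ifs with h
  · rfl
  · exact (map_one E.gAut).symm

theorem relabel_h (E : TwoEquivalence S S') {K : AbstractSimplicialComplex V}
    (l : Labelling G H K) {i j k : V} (hij : i < j) (hjk : j < k) (hK : {i, j, k} ∈ K.faces) :
    (E.relabel K l).h i j k = E.newLabel (l.g j k) (l.g i j) (l.h i j k) := by
  classical
  have hcard : ({i, j, k} : Finset V).card = 2 + 1 :=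
    Finset.card_eq_three.2 ⟨i, j, k, hij.ne, (hij.trans hjk).ne, hjk.ne, rfl⟩
  have hemb : ![i, j, k] = ({i, j, k} : Finset V).orderEmbOfFin hcard := by
    refine Finset.orderEmbOfFin_unique hcard (fun x => ?_) ?_
    · fin_cases x <;> simp
    · rw [Fin.strictMono_iff_lt_succ]
      intro x
      fin_cases x
      exacts [hij, hjk]
  have h0 : ({i, j, k} : Finset V).orderEmbOfFin hcard 0 = i := (congrFun hemb 0).symm
  have h1 : ({i, j, k} : Finset V).orderEmbOfFin hcard 1 = j := (congrFun hemb 1).symm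
  have h2 : ({i, j, k} : Finset V).orderEmbOfFin hcard 2 = k := (congrFun hemb 2).symm
  have hh : ({i, j, k} : Finset V) ∈ K.faces ∧ ({i, j, k} : Finset V).card = 2 + 1 := ⟨hK, hcard⟩
  have e₁ : l.h i j k = l.2 ⟨{i, j, k}, hh⟩ := by
    unfold Labelling.h
    split_ifs with h
    · congr!
    · exact absurd (by convert hh) h
  have e₂ : (E.relabel K l).h i j k = (E.relabel K l).2 ⟨{i, j, k}, hh⟩ := by
    unfold Labelling.h
    split_ifs with h
    · congr!
    · exact absurd (by convert hh) h
  rw [e₁, e₂, newLabel, ← edgeLabel_fst, ← edgeLabel_fst]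
  change E.hAut (l.2 ⟨{i, j, k}, hh⟩) *
    E.Φ (edgeLabel l.1 (({i, j, k} : Finset V).orderEmbOfFin hcard 1)
        (({i, j, k} : Finset V).orderEmbOfFin hcard 2))
      (edgeLabel l.1 (({i, j, k} : Finset V).orderEmbOfFin hcard 0)
        (({i, j, k} : Finset V).orderEmbOfFin hcard 1)) = _
  rw [h0, h1, h2]

theorem newLabel_flat_iff (E : TwoEquivalence S S') (g₁ g₂ g₃ : G) (k l m n : H) :
    E.newLabel g₁ g₂ n * (E.newLabel g₁ (g₂ * g₃) k)⁻¹ * E.newLabel (g₁ * g₂) g₃ m *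
        (E.newLabel g₂ g₃ l)⁻¹ = S'.α₀ (E.gAut g₁) (E.gAut g₂) (E.gAut g₃) ↔
      n * k⁻¹ * m * l⁻¹ = S.α₀ g₁ g₂ g₃ := by
  have e : S'.α₀ (E.gAut g₁) (E.gAut g₂) (E.gAut g₃) = E.hAut (S.α₀ g₁ g₂ g₃) *
      (E.Φ (g₁ * g₂) g₃ * E.Φ g₁ g₂ * (E.Φ g₁ (g₂ * g₃))⁻¹ * (E.Φ g₂ g₃)⁻¹) := by
    have h := congrArg Additive.ofMul (E.cond_α₀ g₁ g₂ g₃)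
    apply Additive.ofMul.injective
    simp only [ofMul_mul, ofMul_inv] at h ⊢
    linear_combination (norm := abel) -h
  have e' : E.newLabel g₁ g₂ n * (E.newLabel g₁ (g₂ * g₃) k)⁻¹ * E.newLabel (g₁ * g₂) g₃ m *
      (E.newLabel g₂ g₃ l)⁻¹ = E.hAut (n * k⁻¹ * m * l⁻¹) *
      (E.Φ (g₁ * g₂) g₃ * E.Φ g₁ g₂ * (E.Φ g₁ (g₂ * g₃))⁻¹ * (E.Φ g₂ g₃)⁻¹) := by
    apply Additive.ofMul.injective
    simp only [newLabel, map_mul, map_inv, ofMul_mul, ofMul_inv]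
    abel
  rw [e, e', mul_left_inj, E.hAut.injective.eq_iff]

end TwoEquivalence

theorem eq_mul_of_flat {x y z : G} (h : x * y⁻¹ * z = 1) : y = z * x := by
  rw [mul_eq_one_iff_eq_inv, mul_inv_eq_iff_eq_mul] at h
  rw [h, mul_inv_cancel_left]

theorem eq_mul_of_flat' {a k l m n : H} (h : n * k⁻¹ * m * l⁻¹ = a) : k * l * a = m * n := by
  subst h
  apply Additive.ofMul.injective
  simp only [ofMul_mul, ofMul_inv]
  abel

theorem TwoEquivalence.isSemiFlat_relabel (E : TwoEquivalence S S')
    {K : AbstractSimplicialComplex V} (l : Labelling G H K) :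
    IsSemiFlat S.toStructureMaps l ↔ IsSemiFlat S'.toStructureMaps (E.relabel K l) := by
  rw [IsSemiFlat, IsSemiFlat]
  simp only [E.relabel_g, ← map_inv, ← map_mul, map_eq_one_iff E.gAut E.gAut.injective]
  refine and_congr_right fun hg => ?_
  refine forall₄_congr fun i j k m => forall₄_congr fun hij hjk hkm hK => ?_
  have face : ∀ {t : Finset V}, t ⊆ {i, j, k, m} → t.Nonempty → t ∈ K.faces := fun h₁ h₂ =>
    (K.isRelLowerSet_faces hK).2 h₁ h₂
  have f₁ : {j, k, m} ∈ K.faces := face (by simp) (by simp)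
  have f₂ : {i, k, m} ∈ K.faces := face (by grind) (by simp)
  have f₃ : {i, j, m} ∈ K.faces := face (by grind) (by simp)
  have f₄ : {i, j, k} ∈ K.faces := face (by grind) (by simp)
  rw [E.relabel_h l hjk hkm f₁, E.relabel_h l (hij.trans hjk) hkm f₂,
    E.relabel_h l hij (hjk.trans hkm) f₃, E.relabel_h l hij hjk f₄,
    eq_mul_of_flat (hg i j k hij hjk f₄), eq_mul_of_flat (hg j k m hjk hkm f₁),
    E.newLabel_flat_iff]

end Labellings

/-! ### Invariance of the state-sum -/

section Invariance

variable {G H R V : Type*} [Group G] [CommGroup H] [CommRing R] [StarRing R] [LinearOrder V]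
  {S S' : SemiWeakStructure G H R}

namespace TwoEquivalence

/-- The defect of the tetrahedron with the vertices `w 0 < w 1 < w 2 < w 3` in the labelling `l`. -/
noncomputable def defectAt (E : TwoEquivalence S S') {K : AbstractSimplicialComplex V}
    (l : Labelling G H K) (w : Fin 4 → V) : Rˣ :=
  E.defect (l.g (w 2) (w 3)) (l.g (w 1) (w 2)) (l.g (w 0) (w 1)) (l.h (w 0) (w 2) (w 3))
    (l.h (w 0) (w 1) (w 2)) (l.h (w 0) (w 1) (w 3)) (l.h (w 1) (w 2) (w 3))

theorem partitionFunction_relabel (E : TwoEquivalence S S') {K : AbstractSimplicialComplex V}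
    {l : Labelling G H K} (hl : IsSemiFlat S.toStructureMaps l) {v₀ v₁ v₂ v₃ v₄ : V}
    (h01 : v₀ < v₁) (h12 : v₁ < v₂) (h23 : v₂ < v₃) (h34 : v₃ < v₄)
    (hK : {v₀, v₁, v₂, v₃, v₄} ∈ K.faces) :
    partitionFunction S'.toStructureMaps (E.relabel K l) v₀ v₁ v₂ v₃ v₄ =
      E.uAut (partitionFunction S.toStructureMaps l v₀ v₁ v₂ v₃ v₄) *
        (E.defectAt l ![v₁, v₂, v₃, v₄] * (E.defectAt l ![v₀, v₂, v₃, v₄])⁻¹ *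
          E.defectAt l ![v₀, v₁, v₃, v₄] * (E.defectAt l ![v₀, v₁, v₂, v₄])⁻¹ *
          E.defectAt l ![v₀, v₁, v₂, v₃])⁻¹ := by
  have face : ∀ {t : Finset V}, t ⊆ {v₀, v₁, v₂, v₃, v₄} → t.Nonempty → t ∈ K.faces :=
    fun h₁ h₂ => (K.isRelLowerSet_faces hK).2 h₁ h₂
  have h02 := h01.trans h12
  have h13 := h12.trans h23
  have h24 := h23.trans h34
  have h03 := h02.trans h23
  have h14 := h13.trans h34
  have f012 : {v₀, v₁, v₂} ∈ K.faces := face (by grind) (by simp)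
  have f013 : {v₀, v₁, v₃} ∈ K.faces := face (by grind) (by simp)
  have f014 : {v₀, v₁, v₄} ∈ K.faces := face (by grind) (by simp)
  have f023 : {v₀, v₂, v₃} ∈ K.faces := face (by grind) (by simp)
  have f024 : {v₀, v₂, v₄} ∈ K.faces := face (by grind) (by simp)
  have f034 : {v₀, v₃, v₄} ∈ K.faces := face (by grind) (by simp)
  have f123 : {v₁, v₂, v₃} ∈ K.faces := face (by grind) (by simp)
  have f124 : {v₁, v₂, v₄} ∈ K.faces := face (by grind) (by simp)
  have f134 : {v₁, v₃, v₄} ∈ K.faces := face (by grind) (by simp)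
  have f234 : {v₂, v₃, v₄} ∈ K.faces := face (by grind) (by simp)
  have g02 := eq_mul_of_flat (hl.1 _ _ _ h01 h12 f012)
  have g13 := eq_mul_of_flat (hl.1 _ _ _ h12 h23 f123)
  have g24 := eq_mul_of_flat (hl.1 _ _ _ h23 h34 f234)
  have g03 := eq_mul_of_flat (hl.1 _ _ _ h02 h23 f023)
  have g14 := eq_mul_of_flat (hl.1 _ _ _ h13 h34 f134)
  have t0123 := eq_mul_of_flat' (hl.2 _ _ _ _ h01 h12 h23 (face (by grind) (by simp)))
  have t0124 := eq_mul_of_flat' (hl.2 _ _ _ _ h01 h12 h24 (face (by grind) (by simp)))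
  have t0134 := eq_mul_of_flat' (hl.2 _ _ _ _ h01 h13 h34 (face (by grind) (by simp)))
  have t0234 := eq_mul_of_flat' (hl.2 _ _ _ _ h02 h23 h34 (face (by grind) (by simp)))
  have t1234 := eq_mul_of_flat' (hl.2 _ _ _ _ h12 h23 h34 (face (by grind) (by simp)))
  rw [g24] at t0124
  rw [g13] at t0134
  rw [g02] at t0234
  have key := E.simplexScalar_newLabel (l.g v₃ v₄) (l.g v₂ v₃) (l.g v₁ v₂) (l.g v₀ v₁)
    _ _ _ _ _ _ _ _ _ _ t0123 t0124 t0134 t0234 t1234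
  have lhs : partitionFunction S'.toStructureMaps (E.relabel K l) v₀ v₁ v₂ v₃ v₄ =
      simplexScalar S'.toStructureMaps ((E.relabel K l).g v₃ v₄) ((E.relabel K l).g v₂ v₃)
        ((E.relabel K l).g v₁ v₂) ((E.relabel K l).g v₀ v₁) ((E.relabel K l).h v₀ v₁ v₂)
        ((E.relabel K l).h v₀ v₁ v₃) ((E.relabel K l).h v₀ v₁ v₄) ((E.relabel K l).h v₀ v₂ v₃)
        ((E.relabel K l).h v₀ v₂ v₄) ((E.relabel K l).h v₀ v₃ v₄) ((E.relabel K l).h v₁ v₂ v₃)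
        ((E.relabel K l).h v₁ v₂ v₄) ((E.relabel K l).h v₁ v₃ v₄)
        ((E.relabel K l).h v₂ v₃ v₄) := rfl
  have rhs : partitionFunction S.toStructureMaps l v₀ v₁ v₂ v₃ v₄ =
      simplexScalar S.toStructureMaps (l.g v₃ v₄) (l.g v₂ v₃) (l.g v₁ v₂) (l.g v₀ v₁)
        (l.h v₀ v₁ v₂) (l.h v₀ v₁ v₃) (l.h v₀ v₁ v₄) (l.h v₀ v₂ v₃) (l.h v₀ v₂ v₄) (l.h v₀ v₃ v₄)
        (l.h v₁ v₂ v₃) (l.h v₁ v₂ v₄) (l.h v₁ v₃ v₄) (l.h v₂ v₃ v₄) := rfl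
  have defectAt_eq : ∀ i j k m : V, E.defectAt l ![i, j, k, m] = E.defect (l.g k m) (l.g j k)
    (l.g i j) (l.h i k m) (l.h i j k) (l.h i j m) (l.h j k m) := fun _ _ _ _ => rfl
  rw [lhs, rhs]
  simp only [E.relabel_g]
  rw [E.relabel_h l h01 h12 f012, E.relabel_h l h01 h13 f013,
    E.relabel_h l h01 (h13.trans h34) f014, E.relabel_h l h02 h23 f023, E.relabel_h l h02 h24 f024,
    E.relabel_h l h03 h34 f034, E.relabel_h l h12 h23 f123, E.relabel_h l h12 h24 f124,
    E.relabel_h l h13 h34 f134, E.relabel_h l h23 h34 f234, g14, g03, g24, g13, g02, key]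
  simp only [defectAt_eq, g24, g13, g02]
  apply Additive.ofMul.injective
  simp only [ofMul_mul, ofMul_inv]
  abel

theorem simplexWeight_relabel (E : TwoEquivalence S S') {K : AbstractSimplicialComplex V}
    {l : Labelling G H K} (hl : IsSemiFlat S.toStructureMaps l) (s : KSimplex K 4) :
    simplexWeight S'.toStructureMaps (E.relabel K l) s =
      E.uAut (simplexWeight S.toStructureMaps l s) *
        (∏ i : Fin 5, E.defectAt l (orderedVertices s ∘ i.succAbove) ^
          (((-1) ^ (i : ℕ) : ℤˣ) : ℤ))⁻¹ := by
  have hprod : ∏ i : Fin 5, E.defectAt l (orderedVertices s ∘ i.succAbove) ^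
      (((-1) ^ (i : ℕ) : ℤˣ) : ℤ) =
      E.defectAt l ![orderedVertices s 1, orderedVertices s 2, orderedVertices s 3,
          orderedVertices s 4] *
        (E.defectAt l ![orderedVertices s 0, orderedVertices s 2, orderedVertices s 3,
          orderedVertices s 4])⁻¹ *
        E.defectAt l ![orderedVertices s 0, orderedVertices s 1, orderedVertices s 3,
          orderedVertices s 4] *
        (E.defectAt l ![orderedVertices s 0, orderedVertices s 1, orderedVertices s 2,
          orderedVertices s 4])⁻¹ *
        E.defectAt l ![orderedVertices s 0, orderedVertices s 1, orderedVertices s 2,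
          orderedVertices s 3] := by
    rw [Fin.prod_univ_five]
    congr 1
    · congr 1
      · congr 1
        · congr 1
          · rw [show (((-1) ^ ((0 : Fin 5) : ℕ) : ℤˣ) : ℤ) = 1 from rfl, zpow_one]
            congr 1; funext j; fin_cases j <;> rfl
          · rw [show (((-1) ^ ((1 : Fin 5) : ℕ) : ℤˣ) : ℤ) = -1 from rfl, zpow_neg_one]
            congr 2; funext j; fin_cases j <;> rfl
        · rw [show (((-1) ^ ((2 : Fin 5) : ℕ) : ℤˣ) : ℤ) = 1 from rfl, zpow_one]
          congr 1; funext j; fin_cases j <;> rfl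
      · rw [show (((-1) ^ ((3 : Fin 5) : ℕ) : ℤˣ) : ℤ) = -1 from rfl, zpow_neg_one]
        congr 2; funext j; fin_cases j <;> rfl
    · rw [show (((-1) ^ ((4 : Fin 5) : ℕ) : ℤˣ) : ℤ) = 1 from rfl, zpow_one]
      congr 1; funext j; fin_cases j <;> rfl
  have hlt := orderedVertices_strictMono s
  rw [hprod, simplexWeight, simplexWeight]
  refine E.partitionFunction_relabel hl (hlt (by decide)) (hlt (by decide)) (hlt (by decide))
    (hlt (by decide)) ?_
  have himage := image_orderedVertices s
  have huniv : (Finset.univ : Finset (Fin 5)) = {0, 1, 2, 3, 4} := by decide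
  rw [huniv] at himage
  simp only [Finset.image_insert, Finset.image_singleton] at himage
  rw [himage]
  exact s.2.1

theorem prod_simplexWeight_relabel [Fintype V] (E : TwoEquivalence S S')
    (T : TriangulatedFourManifold V) {l : Labelling G H T.complex}
    (hl : IsSemiFlat S.toStructureMaps l) :
    ∏ s : KSimplex T.complex 4, simplexWeight S'.toStructureMaps (E.relabel T.complex l) s ^
        ((T.orient (orderedVertices s) : ℤˣ) : ℤ) =
      E.uAut (∏ s : KSimplex T.complex 4, simplexWeight S.toStructureMaps l s ^
        ((T.orient (orderedVertices s) : ℤˣ) : ℤ)) := by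
  have h := prod_boundary T (E.defectAt l)
  have h' : ∏ s : KSimplex T.complex 4, (∏ i : Fin 5,
      E.defectAt l (orderedVertices s ∘ i.succAbove) ^ (((-1) ^ (i : ℕ) : ℤˣ) : ℤ)) ^
        ((T.orient (orderedVertices s) : ℤˣ) : ℤ) = 1 := by
    rw [← h]
    refine Finset.prod_congr rfl fun s _ => ?_
    rw [← Finset.prod_zpow]
    refine Finset.prod_congr rfl fun i _ => ?_
    rw [Units.val_mul, zpow_mul]
  simp only [E.simplexWeight_relabel hl, mul_zpow, inv_zpow, Finset.prod_mul_distrib,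
    Finset.prod_inv_distrib, h', inv_one, mul_one, map_prod, map_zpow]

theorem rAut_units_val (E : TwoEquivalence S S') (u : Rˣ) : E.rAut (u : R) = (E.uAut u : Rˣ) := rfl

theorem uAut_unit_natCast (E : TwoEquivalence S S') {n : ℕ} (h : IsUnit (n : R)) :
    E.uAut h.unit = h.unit := by
  apply Units.ext
  rw [← E.rAut_units_val, IsUnit.unit_spec, map_natCast]

end TwoEquivalence

end Invariance

theorem theorem2 {G H R V : Type*} [Group G] [Finite G] [CommGroup H] [Finite H]
    [CommRing R] [StarRing R]
    (hG : IsUnit (Nat.card G : R)) (hH : IsUnit (Nat.card H : R))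
    (S S' : SemiWeakStructure G H R) (E : TwoEquivalence S S')
    [Fintype V] [LinearOrder V] (T : TriangulatedFourManifold V) :
    stateSum hG hH S' T = E.rAut (stateSum hG hH S T) ∧
      ((∀ r : R, E.rAut r = r) → stateSum hG hH S' T = stateSum hG hH S T) := by
  have main : stateSum hG hH S' T = E.rAut (stateSum hG hH S T) := by
    simp only [stateSum, map_mul, map_sum, E.rAut_units_val, map_zpow, E.uAut_unit_natCast]
    congr 1
    refine (Fintype.sum_equiv ((E.relabel T.complex).subtypeEquiv E.isSemiFlat_relabel) _ _
      fun L => ?_).symm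
    exact congrArg Units.val (E.prod_simplexWeight_relabel T L.2).symm
  exact ⟨main, fun h => main.trans (h _)⟩
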